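/- Let $n\ge 2$, $d\ge 0$, and let $G$ be a connected undirected graph on $\{1,\dots,n\}$ with symmetric weights $a_{ij}$ ($a_{ij}>0$ if $\{i,j\}$ is an edge, $a_{ij}=0$ otherwise), Laplacian $L$ ($L_{ij}=-a_{ij}$ for $i\ne j$, $L_{ii}=\sum_j a_{ij}$) with eigenvalues $0=\lambda_1<\lambda_2\le\dots\le\lambda_n$, and $N_i=\{j: L_{ij}\neq 0\}$. A map $C:\mathbb R^d\times\mathbb R_+\to\mathbb R^d$ is a spatio-temporal (ST) compressor if (P1) for some $k>0$ the system $\dot y=-kC(y,t)$ is uniformly globally exponentially stable (UGES) at the origin, i.e. $kC(0,t)\equiv 0$ and there are $K,\mu>0$ with $\|y(t)\|\le K\|y(t_0)\|e^{-\mu(t-t_0)}$ for all $t\ge t_0\ge 0$ and all solutions $y$, and (P2) for some $L_c>0$, $\|C(y,t)-C(0,t)\|\le L_c\|y\|$ for all $y\in\mathbb R^d$, $t\ge0$. Let $C$ be an ST compressor, normalized so that P1 holds with $k=1$. Call a $C^1$ function $V:\mathbb R^d\times\mathbb R_+\to\mathbb R$ a Lyapunov function for $C$ with constants $c_1,c_2,c_3,c_4>0$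 if for all $y\in\mathbb R^d$, $t\ge0$, $$c_1\|y\|^2\le V(y,t)\le c_2\|y\|^2,\qquad \frac{\partial V}{\partial t}-\frac{\partial V}{\partial y}C(y,t)\le -c_3\|y\|^2,\qquad \Big\|\frac{\partial V}{\partial y}\Big\|\le c_4\|y\| .$$ (i) If $C$ is continuously differentiable on $\mathbb R^d\times\mathbb R_+$ and Lipschitz in $y$ uniformly in $t$, then a Lyapunov function for $C$ with some constants $c_1,\dots,c_4>0$ exists. (ii) For every Lyapunov function for $C$, with constants $c_1,\dots,c_4$, put $\alpha^*=\min\left\{\frac{2c_3}{9\lambda_nc_4\sqrt n},\frac{2c_3}{3\lambda_n}\right\}$. Then for every $0<\alpha\le\alpha^*$ and every (Carathéodory) solution on $[0,\infty)$ of the observer-based compressed consensus flow $$\dot x_i=-\alpha\sum_{j\in N_i}L_{ij}\hat x^i_j,\qquad \dot{\hat x}^i_j=C(x_j-\hat x^j_j,t)\quad (j\in N_i),\qquad i=1,\dots,n,$$ with $\hat x^j_i(0)=\hat x^{j'}_i(0)$ for all $i$ and all $j,j'\in N_i$, one has, for each $i$, $$\Big\|x_i(t)-\frac1n\sum_{j=1}^n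 x_j(0)\Big\|^2=\mathcal O(e^{-\gamma t})\quad (t\to\infty),\qquad \gamma=\min\left\{\frac{\alpha\lambda_2}{2},\frac{c_3}{3c_1}\right\}.$$ -/

import Mathlib

open MeasureTheory Set Filter Topology Asymptotics
open scoped BigOperators

/-! ## Differential equations and uniform global exponential stability -/

/-- `u` satisfies `du/dt = v` on `[t₀, ∞)` in the sense of Carathéodory, that is, `u` is locally
absolutely continuous with derivative `v` almost everywhere. Every classical solution whose
derivative is locally bounded is a solution in this sense. -/
def SolvesFrom {E : Type*} [NormedAddCommGroup E] [NormedSpace ℝ E]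
    (t₀ : ℝ) (u v : ℝ → E) : Prop :=
  ∀ t, t₀ ≤ t → IntervalIntegrable v volume t₀ t ∧ u t = u t₀ + ∫ s in t₀..t, v s

/-- The non-autonomous system `dy/dt = f (y, t)`, `t ≥ 0`, is uniformly globally exponentially
stable at the origin: the origin is an equilibrium and every solution, started at any time
`t₀ ≥ 0`, satisfies one and the same exponential bound. -/
def UGES {E : Type*} [NormedAddCommGroup E] [NormedSpace ℝ E] (f : E → ℝ → E) : Prop :=
  (∀ t, 0 ≤ t → f 0 t = 0) ∧
  ∃ K > (0 : ℝ), ∃ μ > (0 : ℝ), ∀ t₀, 0 ≤ t₀ → ∀ y : ℝ → E,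
    SolvesFrom t₀ y (fun s => f (y s) s) →
    ∀ t, t₀ ≤ t → ‖y t‖ ≤ K * ‖y t₀‖ * Real.exp (-μ * (t - t₀))

/-! ## Spatio-temporal compressors and their Lyapunov functions -/

/-- Spatio-temporal (ST) compressor `C : ℝᵈ × ℝ₊ → ℝᵈ` (only times `t ≥ 0` matter). -/
structure IsSTCompressor {d : ℕ}
    (C : EuclideanSpace ℝ (Fin d) → ℝ → EuclideanSpace ℝ (Fin d)) : Prop where
  exists_uges : ∃ k > (0 : ℝ), UGES (fun y t => -(k • C y t))
  exists_bound : ∃ Lc > (0 : ℝ), ∀ y t, 0 ≤ t → ‖C y t - C 0 t‖ ≤ Lc * ‖y - 0‖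

/-- `V : ℝᵈ × ℝ₊ → ℝ` is a continuously differentiable quadratic-type Lyapunov function for the
system `dy/dt = -C (y, t)`, with constants `c₁, c₂, c₃, c₄ > 0`. At `t = 0` the time derivative
is the one-sided one. -/
structure IsLyapunovFor {d : ℕ}
    (C : EuclideanSpace ℝ (Fin d) → ℝ → EuclideanSpace ℝ (Fin d))
    (V : EuclideanSpace ℝ (Fin d) → ℝ → ℝ) (c₁ c₂ c₃ c₄ : ℝ) : Prop where
  c₁_pos : 0 < c₁
  c₂_pos : 0 < c₂
  c₃_pos : 0 < c₃
  c₄_pos : 0 < c₄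
  contDiff : ContDiffOn ℝ 1 (fun p : EuclideanSpace ℝ (Fin d) × ℝ => V p.1 p.2)
    (univ ×ˢ Ici (0 : ℝ))
  lower : ∀ y t, 0 ≤ t → c₁ * ‖y‖ ^ 2 ≤ V y t
  upper : ∀ y t, 0 ≤ t → V y t ≤ c₂ * ‖y‖ ^ 2
  decay : ∀ y t, 0 ≤ t →
    derivWithin (fun s => V y s) (Ici (0 : ℝ)) t - fderiv ℝ (fun z => V z t) y (C y t)
      ≤ -c₃ * ‖y‖ ^ 2
  gradient : ∀ y t, 0 ≤ t → ‖fderiv ℝ (fun z => V z t) y‖ ≤ c₄ * ‖y‖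

/-! ## Weighted undirected graphs and their Laplacians -/

/-- `a` is a weight matrix of the undirected graph `G`. -/
structure IsWeightMatrix {n : ℕ} (G : SimpleGraph (Fin n)) (a : Matrix (Fin n) (Fin n) ℝ) :
    Prop where
  symm : a.IsSymm
  pos : ∀ i j, G.Adj i j → 0 < a i j
  zero : ∀ i j, ¬ G.Adj i j → a i j = 0

/-- The Laplacian of a weight matrix. -/
def laplacian {n : ℕ} (a : Matrix (Fin n) (Fin n) ℝ) : Matrix (Fin n) (Fin n) ℝ :=
  Matrix.of fun i j => if i = j then ∑ k, a i k else -a i j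

theorem laplacian_isHermitian {n : ℕ} {a : Matrix (Fin n) (Fin n) ℝ} (ha : a.IsSymm) :
    (laplacian a).IsHermitian := by
  refine Matrix.IsHermitian.ext fun i j => ?_
  by_cases h : i = j
  · subst h
    simp
  · simp [laplacian, h, Ne.symm h, ha.apply]

/-- The eigenvalues of the Laplacian in ascending order, with multiplicity, counted from `0`:
`lapEigenvalue ha 0 ≤ lapEigenvalue ha 1 ≤ …` (Mathlib's `eigenvalues₀` is descending). -/
noncomputable def lapEigenvalue {n : ℕ} {a : Matrix (Fin n) (Fin n) ℝ} (ha : a.IsSymm)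
    (k : Fin n) : ℝ :=
  (laplacian_isHermitian ha).eigenvalues₀ (Fin.cast (Fintype.card_fin n).symm k.rev)

open scoped Classical in
/-- The neighbour set of agent `i`: all `j` (also `j = i`) with nonzero Laplacian entry. -/
noncomputable def nbrs {n : ℕ} (a : Matrix (Fin n) (Fin n) ℝ) (i : Fin n) : Finset (Fin n) :=
  Finset.univ.filter fun j => laplacian a i j ≠ 0

/-! ## The consensus flow with observer-based compression -/

/-- `(x, xh)` is a solution on `[0, ∞)` of the consensus flow with observer-based compression.
Here `x i` is the state of agent `i` and `xh i j`, `j ∈ nbrs a i`, is the estimate of `x j` that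
agent `i` stores; the values `xh i j` with `j ∉ nbrs a i` play no role. -/
structure IsDCOCFlow {n d : ℕ} (a : Matrix (Fin n) (Fin n) ℝ)
    (C : EuclideanSpace ℝ (Fin d) → ℝ → EuclideanSpace ℝ (Fin d)) (α : ℝ)
    (x : Fin n → ℝ → EuclideanSpace ℝ (Fin d))
    (xh : Fin n → Fin n → ℝ → EuclideanSpace ℝ (Fin d)) : Prop where
  init : ∀ i, ∀ j ∈ nbrs a i, ∀ j' ∈ nbrs a i, xh j i 0 = xh j' i 0
  state : ∀ i, SolvesFrom 0 (x i)
    (fun s => -(α • ∑ j ∈ nbrs a i, laplacian a i j • xh i j s))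
  observer : ∀ i, ∀ j ∈ nbrs a i, SolvesFrom 0 (xh i j)
    (fun s => C (x j s - xh j j s) s)

/-! ## Quadratic forms of Hermitian matrices and Laplacians -/

/-! Rate bound. All estimates of agent `j` obey the same equation from the same initial value, so
they coincide. With disagreement `X i = x i - m`, where `m` is the initial average, and error `Y i =
x i - xh i i`, the flow is `X' = -α L (X - Y)`, `Y' = -C(Y, t) + X'`, and the sum of the states is
conserved. The composite function `W = ∑ V(Y i, t) + c₄ ∑ ‖X i‖²` satisfies `W' ≤ -(α λ₂ / 2) W`
once `3 α λₙ c₄ ≤ c₃`, and the prescribed gain bound implies this inequality. The spectral inputs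
are `‖L X‖² ≤ λₙ ⟨X, L X⟩`, `⟨Y, L Y⟩ ≤ λₙ ‖Y‖²`, and `λ₂ ‖X‖² ≤ ⟨X, L X⟩` when `∑ X i = 0`; they
are combined in `IsWeightMatrix.dissipation_estimate`. Since `C` may be discontinuous, trajectories
are only locally Lipschitz. Hence `W` is absolutely continuous, and an almost everywhere
differential inequality suffices (`le_exp_mul_of_ae_deriv_le`). The rate `α λ₂ / 2` is at least the
minimum `γ`.

Existence of `V`. The classical choice is the squared norm of the solution, integrated over a long
horizon `T`. Picard iterates replace the solution operator: they are jointly `C¹` by construction,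
so differentiability of the flow in its initial data is never needed. The exact flow is invariant in
the direction `(f, 1, -1)`; the `N`-th iterate is invariant up to an error of order `(L T)^N / N!`
(`norm_fderiv_picard_flow_le`). Along the field the energy therefore changes by at most `‖picard at
T‖² - ‖y‖²` plus a small multiple of `‖y‖²`. Exponential stability makes the first term small for
large `T`, and large `N` controls the errors. Odd reflection in time first extends the field to a
`C¹` one on all of `ℝ`. -/

theorem Matrix.IsHermitian.exists_eigen_coords {n : ℕ} {A : Matrix (Fin n) (Fin n) ℝ}
    (hA : A.IsHermitian) (w : Fin n → ℝ) :
    ∃ c : Fin n → ℝ, (∀ m, c m = hA.eigenvectorBasis m ⬝ᵥ w) ∧ (∑ i, w i ^ 2 = ∑ m, c m ^ 2) ∧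
      (w ⬝ᵥ (A.mulVec w) = ∑ m, hA.eigenvalues m * c m ^ 2) ∧
      (∑ i, (A.mulVec w) i ^ 2 = ∑ m, hA.eigenvalues m ^ 2 * c m ^ 2) := by
  set b := hA.eigenvectorBasis
  have hin : ∀ u v : Fin n → ℝ, inner ℝ (WithLp.toLp 2 u) (WithLp.toLp 2 v) = u ⬝ᵥ v := by
    intro u v
    simp [PiLp.inner_apply, dotProduct, mul_comm]
  have hb : ∀ (m) (v : Fin n → ℝ), inner ℝ (b m) (WithLp.toLp 2 v) = b m ⬝ᵥ v := fun m v =>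
    hin (b m) v
  have hbA : ∀ m (v : Fin n → ℝ), b m ⬝ᵥ (A.mulVec v) = hA.eigenvalues m * (b m ⬝ᵥ v) := by
    intro m v
    have h1 : A.transpose = A := by simpa [Matrix.IsHermitian] using hA
    rw [Matrix.dotProduct_mulVec, ← Matrix.mulVec_transpose, h1, hA.mulVec_eigenvectorBasis,
      smul_dotProduct, smul_eq_mul]
  have hpars : ∀ u v : Fin n → ℝ, u ⬝ᵥ v = ∑ m, (b m ⬝ᵥ u) * (b m ⬝ᵥ v) := by
    intro u v
    rw [← hin, ← b.sum_inner_mul_inner]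
    refine Finset.sum_congr rfl fun m _ => ?_
    rw [hb, real_inner_comm, hb]
  have hsq : ∀ u : Fin n → ℝ, ∑ i, u i ^ 2 = ∑ m, (b m ⬝ᵥ u) ^ 2 := by
    intro u
    have := hpars u u
    simpa [dotProduct, sq] using this
  refine ⟨fun m => b m ⬝ᵥ w, fun m => rfl, hsq w, ?_, ?_⟩
  · rw [hpars]
    refine Finset.sum_congr rfl fun m _ => ?_
    rw [hbA]; ring
  · rw [hsq]
    refine Finset.sum_congr rfl fun m _ => ?_
    rw [hbA]; ring

section Laplacian

variable {n : ℕ} {G : SimpleGraph (Fin n)} {a : Matrix (Fin n) (Fin n) ℝ}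

theorem laplacian_row_sum (hd : ∀ i, a i i = 0) (i : Fin n) : ∑ j, laplacian a i j = 0 := by
  have h : ∀ j, laplacian a i j = (if i = j then ∑ k, a i k else 0) - a i j := by
    intro j
    by_cases hij : i = j
    · subst hij; simp [laplacian, hd]
    · simp [laplacian, hij]
  simp [h]

theorem laplacian_symm_apply (ha : a.IsSymm) (i j : Fin n) : laplacian a i j = laplacian a j i := by
  by_cases h : i = j
  · rw [h]
  · simp [laplacian, h, Ne.symm h, ha.apply]

theorem IsWeightMatrix.diag (ha : IsWeightMatrix G a) (i : Fin n) : a i i = 0 :=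
  ha.zero i i (by simp)

theorem IsWeightMatrix.nonneg (ha : IsWeightMatrix G a) (i j : Fin n) : 0 ≤ a i j := by
  by_cases h : G.Adj i j
  · exact (ha.pos i j h).le
  · exact (ha.zero i j h).ge

theorem IsWeightMatrix.dotProduct_laplacian_nonneg (ha : IsWeightMatrix G a) (w : Fin n → ℝ) :
    0 ≤ w ⬝ᵥ ((laplacian a).mulVec w) := by
  -- The Dirichlet form: symmetrizing the double sum turns the quadratic form into a sum of weighted
  -- squares.
  have key : w ⬝ᵥ ((laplacian a).mulVec w) = (∑ i, ∑ j, a i j * (w i - w j) ^ 2) / 2 := by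
    have h1 : w ⬝ᵥ ((laplacian a).mulVec w) = ∑ i, ∑ j, a i j * (w i * (w i - w j)) := by
      simp only [dotProduct, Matrix.mulVec]
      refine Finset.sum_congr rfl fun i _ => ?_
      have h : ∀ j, laplacian a i j * w j =
          (if i = j then (∑ k, a i k) * w j else 0) - a i j * w j := by
        intro j
        by_cases hij : i = j
        · subst hij; simp [laplacian, ha.diag]
        · simp [laplacian, hij]
      simp only [h, Finset.sum_sub_distrib, Finset.sum_ite_eq, Finset.mem_univ, if_true]
      rw [Finset.sum_mul, ← Finset.sum_sub_distrib, Finset.mul_sum]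
      exact Finset.sum_congr rfl fun j _ => by ring
    have h2 : ∑ i, ∑ j, a i j * (w i * (w i - w j)) = ∑ i, ∑ j, a i j * (w j * (w j - w i)) := by
      rw [Finset.sum_comm]
      exact Finset.sum_congr rfl fun i _ => Finset.sum_congr rfl fun j _ => by
        rw [ha.symm.apply]
    have h3 : ∑ i, ∑ j, a i j * (w i - w j) ^ 2 = ∑ i, ∑ j, a i j * (w i * (w i - w j)) +
        ∑ i, ∑ j, a i j * (w j * (w j - w i)) := by
      simp only [← Finset.sum_add_distrib]
      exact Finset.sum_congr rfl fun i _ => Finset.sum_congr rfl fun j _ => by ring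
    rw [h3, ← h2, h1]; ring
  rw [key]
  have : 0 ≤ ∑ i, ∑ j, a i j * (w i - w j) ^ 2 :=
    Finset.sum_nonneg fun i _ => Finset.sum_nonneg fun j _ =>
      mul_nonneg (ha.nonneg i j) (sq_nonneg _)
  positivity

theorem IsWeightMatrix.eigenvalues_nonneg (ha : IsWeightMatrix G a) (m : Fin n) :
    0 ≤ (laplacian_isHermitian ha.symm).eigenvalues m := by
  rw [(laplacian_isHermitian ha.symm).eigenvalues_eq]
  exact ha.dotProduct_laplacian_nonneg _

/-- Links the sorted spectrum, in which `λ₂` and `λₙ` are named, to the indexing of the eigenvector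
basis. -/
theorem exists_eigenvalues_eq_lapEigenvalue (ha : a.IsSymm) :
    ∃ σ : Fin n ≃ Fin n, ∀ k, (laplacian_isHermitian ha).eigenvalues (σ k) = lapEigenvalue ha k := by
  refine ⟨(Fin.revPerm.trans (finCongr (Fintype.card_fin n).symm)).trans
    (Fintype.equivOfCardEq (Fintype.card_fin _)), fun k => ?_⟩
  simp only [Matrix.IsHermitian.eigenvalues, lapEigenvalue, Equiv.trans_apply,
    Equiv.symm_apply_apply]
  rfl

theorem lapEigenvalue_mono (ha : a.IsSymm) : Monotone (lapEigenvalue ha) := by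
  intro k l hkl
  apply (laplacian_isHermitian ha).eigenvalues₀_antitone
  simpa [Fin.le_def] using (Fin.rev_le_rev.mpr hkl)

theorem IsWeightMatrix.sum_sq_laplacian_le (ha : IsWeightMatrix G a) {lam : ℝ}
    (hlam : ∀ k, lapEigenvalue ha.symm k ≤ lam) (w : Fin n → ℝ) :
    ∑ i, ((laplacian a).mulVec w) i ^ 2 ≤ lam * (w ⬝ᵥ ((laplacian a).mulVec w)) ∧
    w ⬝ᵥ ((laplacian a).mulVec w) ≤ lam * ∑ i, w i ^ 2 := by
  obtain ⟨σ, hσ⟩ := exists_eigenvalues_eq_lapEigenvalue ha.symm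
  have hl : ∀ m, (laplacian_isHermitian ha.symm).eigenvalues m ≤ lam := fun m => by
    have := hlam (σ.symm m); rwa [← hσ, Equiv.apply_symm_apply] at this
  obtain ⟨c, -, h1, h2, h3⟩ := (laplacian_isHermitian ha.symm).exists_eigen_coords w
  rw [h1, h2, h3, Finset.mul_sum, Finset.mul_sum]
  constructor
  · refine Finset.sum_le_sum fun m _ => ?_
    have := mul_le_mul_of_nonneg_right (hl m)
      (mul_nonneg (ha.eigenvalues_nonneg m) (sq_nonneg (c m)))
    nlinarith
  · exact Finset.sum_le_sum fun m _ => mul_le_mul_of_nonneg_right (hl m) (sq_nonneg _)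

/-- If `λ₂ > 0`, all eigenvalues but one are at least `λ₂`. The kernel vector of ones then lies on
the remaining eigenvector, so a `w` orthogonal to it has no component there. If `λ₂ ≤ 0`,
nonnegativity of the form is enough. -/
theorem IsWeightMatrix.lapEigenvalue_one_mul_le (ha : IsWeightMatrix G a) (hn : 1 < n)
    {w : Fin n → ℝ} (hw : ∑ i, w i = 0) :
    lapEigenvalue ha.symm ⟨1, hn⟩ * ∑ i, w i ^ 2 ≤ w ⬝ᵥ ((laplacian a).mulVec w) := by
  rcases le_or_gt (lapEigenvalue ha.symm ⟨1, hn⟩) 0 with h0 | h0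
  · exact (mul_nonpos_of_nonpos_of_nonneg h0 (Finset.sum_nonneg fun i _ => sq_nonneg _)).trans
      (ha.dotProduct_laplacian_nonneg w)
  obtain ⟨σ, hσ⟩ := exists_eigenvalues_eq_lapEigenvalue ha.symm
  set hH := laplacian_isHermitian ha.symm
  obtain ⟨m₀, hm₀⟩ : ∃ m₀, ∀ m, m ≠ m₀ → lapEigenvalue ha.symm ⟨1, hn⟩ ≤ hH.eigenvalues m := by
    refine ⟨σ ⟨0, by omega⟩, fun m hm => ?_⟩
    obtain ⟨k, rfl⟩ := σ.surjective m
    rw [hσ]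
    apply lapEigenvalue_mono
    have : k ≠ ⟨0, by omega⟩ := fun h => hm (by rw [h])
    rw [Fin.le_def]
    have : k.val ≠ 0 := fun h => this (Fin.ext h)
    show 1 ≤ k.val
    omega
  obtain ⟨c, hc, h1, h2, -⟩ := hH.exists_eigen_coords w
  obtain ⟨e, he, e1, -, e3⟩ := hH.exists_eigen_coords (fun _ => (1 : ℝ))
  -- Only the Parseval identity for squares is available here; the coordinates of `w + 1` recover
  -- the inner product of `w` and `1` by polarization.
  obtain ⟨f, hf, f1, -, -⟩ := hH.exists_eigen_coords (w + fun _ => (1 : ℝ))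
  have hfe : ∀ m, f m = c m + e m := fun m => by rw [hf, hc, he, dotProduct_add]
  have hL1 : ∀ i, ((laplacian a).mulVec fun _ => (1 : ℝ)) i = 0 := fun i => by
    simpa [Matrix.mulVec, dotProduct] using laplacian_row_sum ha.diag i
  have hez : ∀ m, m ≠ m₀ → e m = 0 := by
    intro m hm
    have hs : ∑ m, hH.eigenvalues m ^ 2 * e m ^ 2 = 0 := by rw [← e3]; simp [hL1]
    have := (Finset.sum_eq_zero_iff_of_nonneg (fun m _ => by positivity)).1 hs m (Finset.mem_univ m)
    have hp : 0 < hH.eigenvalues m := h0.trans_le (hm₀ m hm)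
    rcases mul_eq_zero.1 this with h | h
    · exact absurd h (by positivity)
    · simpa using h
  have hcross : ∑ m, c m * e m = 0 := by
    have h4 : ∑ i, (w i + 1) ^ 2 = ∑ m, (c m + e m) ^ 2 := by simpa [hfe] using f1
    have h5 : ∑ i, (w i + 1) ^ 2 = ∑ i, w i ^ 2 + 2 * ∑ i, w i + ∑ i : Fin n, (1 : ℝ) ^ 2 := by
      rw [Finset.mul_sum, ← Finset.sum_add_distrib, ← Finset.sum_add_distrib]
      exact Finset.sum_congr rfl fun i _ => by ring
    have h6 : ∑ m, (c m + e m) ^ 2 = ∑ m, c m ^ 2 + 2 * ∑ m, c m * e m + ∑ m, e m ^ 2 := by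
      rw [Finset.mul_sum, ← Finset.sum_add_distrib, ← Finset.sum_add_distrib]
      exact Finset.sum_congr rfl fun i _ => by ring
    rw [h5, h6, hw, h1, e1] at h4
    linarith
  have hsingle : c m₀ * e m₀ = 0 := by
    rw [← hcross]
    exact (Finset.sum_eq_single (f := fun m => c m * e m) m₀
      (fun m _ hm => by simp [hez m hm]) (by simp)).symm
  have he0 : e m₀ ≠ 0 := by
    intro h
    have : ∑ m, e m ^ 2 = 0 := Finset.sum_eq_zero fun m _ => by
      by_cases hm : m = m₀
      · rw [hm, h]; simp
      · rw [hez m hm]; simp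
    rw [← e1] at this
    simp at this
    omega
  have hc0 : c m₀ = 0 := (mul_eq_zero.1 hsingle).resolve_right he0
  rw [h1, h2, Finset.mul_sum]
  refine Finset.sum_le_sum fun m _ => ?_
  by_cases hm : m = m₀
  · rw [hm, hc0]; simp
  · exact mul_le_mul_of_nonneg_right (hm₀ m hm) (sq_nonneg _)

/-! ### Vector-valued versions -/

variable {d : ℕ}

/-- The Laplacian acting on families of vectors. -/
noncomputable def lapMap (a : Matrix (Fin n) (Fin n) ℝ)
    (X : Fin n → EuclideanSpace ℝ (Fin d)) (i : Fin n) : EuclideanSpace ℝ (Fin d) :=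
  ∑ j, laplacian a i j • X j

theorem lapMap_apply (X : Fin n → EuclideanSpace ℝ (Fin d)) (i : Fin n) (k : Fin d) :
    lapMap a X i k = ((laplacian a).mulVec fun j => X j k) i := by
  simp [lapMap, Matrix.mulVec, dotProduct]

theorem lapMap_sub (X Y : Fin n → EuclideanSpace ℝ (Fin d)) (i : Fin n) :
    lapMap a (fun j => X j - Y j) i = lapMap a X i - lapMap a Y i := by
  simp [lapMap, smul_sub, Finset.sum_sub_distrib]

theorem lapMap_const (hd : ∀ i, a i i = 0) (v : EuclideanSpace ℝ (Fin d)) (i : Fin n) :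
    lapMap a (fun _ => v) i = 0 := by
  simp [lapMap, ← Finset.sum_smul, laplacian_row_sum hd]

theorem sum_lapMap (ha : IsWeightMatrix G a) (X : Fin n → EuclideanSpace ℝ (Fin d)) :
    ∑ i, lapMap a X i = 0 := by
  simp only [lapMap]
  rw [Finset.sum_comm]
  refine Finset.sum_eq_zero fun j _ => ?_
  rw [← Finset.sum_smul, Finset.sum_congr rfl fun i _ => laplacian_symm_apply ha.symm i j,
    laplacian_row_sum ha.diag, zero_smul]

theorem sum_norm_sq_eq_coords (X : Fin n → EuclideanSpace ℝ (Fin d)) :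
    ∑ i, ‖X i‖ ^ 2 = ∑ k, ∑ i, (X i k) ^ 2 := by
  rw [Finset.sum_comm]
  exact Finset.sum_congr rfl fun i _ => by rw [EuclideanSpace.real_norm_sq_eq]

theorem sum_inner_lapMap_eq_coords (X : Fin n → EuclideanSpace ℝ (Fin d)) :
    ∑ i, inner ℝ (X i) (lapMap a X i) =
      ∑ k, (fun i => X i k) ⬝ᵥ ((laplacian a).mulVec fun j => X j k) := by
  simp only [dotProduct]
  rw [Finset.sum_comm]
  refine Finset.sum_congr rfl fun i _ => ?_
  simp [PiLp.inner_apply, lapMap_apply, mul_comm]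

theorem IsWeightMatrix.sum_inner_lapMap_nonneg (ha : IsWeightMatrix G a)
    (X : Fin n → EuclideanSpace ℝ (Fin d)) : 0 ≤ ∑ i, inner ℝ (X i) (lapMap a X i) := by
  rw [sum_inner_lapMap_eq_coords]
  exact Finset.sum_nonneg fun k _ => ha.dotProduct_laplacian_nonneg _

theorem IsWeightMatrix.sum_norm_sq_lapMap_le (ha : IsWeightMatrix G a) {lam : ℝ}
    (hlam : ∀ k, lapEigenvalue ha.symm k ≤ lam) (X : Fin n → EuclideanSpace ℝ (Fin d)) :
    ∑ i, ‖lapMap a X i‖ ^ 2 ≤ lam * ∑ i, inner ℝ (X i) (lapMap a X i) := by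
  rw [sum_inner_lapMap_eq_coords, sum_norm_sq_eq_coords, Finset.mul_sum]
  refine Finset.sum_le_sum fun k _ => ?_
  simp only [lapMap_apply]
  exact (ha.sum_sq_laplacian_le hlam _).1

theorem IsWeightMatrix.sum_inner_lapMap_le (ha : IsWeightMatrix G a) {lam : ℝ}
    (hlam : ∀ k, lapEigenvalue ha.symm k ≤ lam) (X : Fin n → EuclideanSpace ℝ (Fin d)) :
    ∑ i, inner ℝ (X i) (lapMap a X i) ≤ lam * ∑ i, ‖X i‖ ^ 2 := by
  rw [sum_inner_lapMap_eq_coords, sum_norm_sq_eq_coords, Finset.mul_sum]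
  exact Finset.sum_le_sum fun k _ => (ha.sum_sq_laplacian_le hlam _).2

theorem IsWeightMatrix.lapEigenvalue_one_mul_le_sum_inner (ha : IsWeightMatrix G a) (hn : 1 < n)
    {X : Fin n → EuclideanSpace ℝ (Fin d)} (hX : ∑ i, X i = 0) :
    lapEigenvalue ha.symm ⟨1, hn⟩ * ∑ i, ‖X i‖ ^ 2 ≤ ∑ i, inner ℝ (X i) (lapMap a X i) := by
  rw [sum_inner_lapMap_eq_coords, sum_norm_sq_eq_coords, Finset.mul_sum]
  refine Finset.sum_le_sum fun k _ => ha.lapEigenvalue_one_mul_le hn ?_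
  simpa using congrArg (fun v : EuclideanSpace ℝ (Fin d) => v k) hX

theorem lapEigenvalue_nonneg (ha : IsWeightMatrix G a) (k : Fin n) :
    0 ≤ lapEigenvalue ha.symm k := by
  obtain ⟨σ, hσ⟩ := exists_eigenvalues_eq_lapEigenvalue ha.symm
  rw [← hσ]
  exact ha.eigenvalues_nonneg _

/-- The dissipation estimate of the composite Lyapunov function of the consensus flow. Here `X` is
the disagreement, `Y` the estimation error and `v` the values of the Lyapunov function at `Y`. -/
theorem IsWeightMatrix.dissipation_estimate (ha : IsWeightMatrix G a) (hn : 1 < n)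
    {lam c₃ c₄ α : ℝ} (hlam : ∀ k, lapEigenvalue ha.symm k ≤ lam) (hlam0 : 0 < lam)
    (hc₄ : 0 < c₄) (hα : 0 < α) (hgain : 3 * (α * lam * c₄) ≤ c₃)
    {X Y : Fin n → EuclideanSpace ℝ (Fin d)} (hX : ∑ i, X i = 0) {v : Fin n → ℝ}
    (hv : ∀ i, v i ≤ c₄ * ‖Y i‖ ^ 2) :
    ∑ i, (-c₃ * ‖Y i‖ ^ 2 + c₄ * ‖Y i‖ * ‖-(α • lapMap a (fun j => X j - Y j) i)‖) +
      c₄ * ∑ i, 2 * inner ℝ (X i) (-(α • lapMap a (fun j => X j - Y j) i)) ≤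
    -(α * lapEigenvalue ha.symm ⟨1, hn⟩ / 2) * (∑ i, v i + c₄ * ∑ i, ‖X i‖ ^ 2) := by
  set l := lapEigenvalue ha.symm ⟨1, hn⟩
  have hl0 : 0 ≤ l := lapEigenvalue_nonneg ha _
  have hll : l ≤ lam := hlam _
  have hYL := ha.sum_norm_sq_lapMap_le hlam Y
  have hYq := ha.sum_inner_lapMap_le hlam Y
  have hXL := ha.sum_norm_sq_lapMap_le hlam X
  have hXq := ha.lapEigenvalue_one_mul_le_sum_inner hn hX
  -- Expanded below, this is the Cauchy–Schwarz type bound `2⟨X, L Y⟩ ≤ ⟨X, L X⟩ + ⟨Y, L Y⟩`.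
  have hXY := ha.sum_inner_lapMap_nonneg (fun j => X j - Y j)
  have hsym : ∑ i, inner ℝ (Y i) (lapMap a X i) = ∑ i, inner ℝ (X i) (lapMap a Y i) := by
    simp only [lapMap, inner_sum, inner_smul_right]
    rw [Finset.sum_comm]
    refine Finset.sum_congr rfl fun i _ => Finset.sum_congr rfl fun j _ => ?_
    rw [laplacian_symm_apply ha.symm, real_inner_comm]
  simp only [lapMap_sub, inner_sub_left, inner_sub_right, Finset.sum_sub_distrib, hsym] at hXY
  have hE : 0 ≤ ∑ i, ‖Y i‖ ^ 2 := Finset.sum_nonneg fun i _ => sq_nonneg _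
  have hterm : ∀ i, ‖Y i‖ * ‖-(α • lapMap a (fun j => X j - Y j) i)‖ ≤
      α * (lam * ‖Y i‖ ^ 2 + ‖lapMap a X i‖ ^ 2 / (2 * lam) + ‖lapMap a Y i‖ ^ 2 / (2 * lam)) := by
    intro i
    rw [norm_neg, norm_smul, Real.norm_of_nonneg hα.le, lapMap_sub]
    have h1 := norm_sub_le (lapMap a X i) (lapMap a Y i)
    -- Young's inequality with weight `lam`, chosen so that `‖L X‖² / (2 lam)` is absorbed by half
    -- of `⟨X, L X⟩`.
    have h2 : ∀ p q : ℝ, p * q ≤ lam / 2 * p ^ 2 + q ^ 2 / (2 * lam) := by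
      intro p q
      have : lam / 2 * p ^ 2 + q ^ 2 / (2 * lam) - p * q = (lam * p - q) ^ 2 / (2 * lam) := by
        field_simp; ring
      have h : 0 ≤ (lam * p - q) ^ 2 / (2 * lam) := by positivity
      linarith
    have h3 := h2 ‖Y i‖ ‖lapMap a X i‖
    have h4 := h2 ‖Y i‖ ‖lapMap a Y i‖
    have h5 := mul_le_mul_of_nonneg_left h1 (norm_nonneg (Y i))
    have h6 : ‖Y i‖ * ‖lapMap a X i - lapMap a Y i‖ ≤
      lam * ‖Y i‖ ^ 2 + ‖lapMap a X i‖ ^ 2 / (2 * lam) + ‖lapMap a Y i‖ ^ 2 / (2 * lam) := by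
      linarith
    calc _ = α * (‖Y i‖ * ‖lapMap a X i - lapMap a Y i‖) := by ring
      _ ≤ _ := mul_le_mul_of_nonneg_left h6 hα.le
  set E := ∑ i, ‖Y i‖ ^ 2 with hEdef
  set D := ∑ i, ‖X i‖ ^ 2 with hDdef
  set q := ∑ i, inner ℝ (X i) (lapMap a X i) with hqdef
  set r := ∑ i, inner ℝ (X i) (lapMap a Y i) with hrdef
  set p := ∑ i, inner ℝ (Y i) (lapMap a Y i) with hpdef
  have hsum1 : ∑ i, (-c₃ * ‖Y i‖ ^ 2 + c₄ * ‖Y i‖ * ‖-(α • lapMap a (fun j => X j - Y j) i)‖) ≤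
      -c₃ * E + c₄ * (α * (lam * E + q / 2 + lam * E / 2)) := by
    have h1 : ∑ i, ‖Y i‖ * ‖-(α • lapMap a (fun j => X j - Y j) i)‖ ≤
        α * (lam * E + (∑ i, ‖lapMap a X i‖ ^ 2) / (2 * lam) +
          (∑ i, ‖lapMap a Y i‖ ^ 2) / (2 * lam)) := by
      refine (Finset.sum_le_sum fun i _ => hterm i).trans (le_of_eq ?_)
      rw [← Finset.mul_sum, Finset.sum_add_distrib, Finset.sum_add_distrib, ← Finset.mul_sum,
        Finset.sum_div, Finset.sum_div]
    have h2 : (∑ i, ‖lapMap a X i‖ ^ 2) / (2 * lam) ≤ q / 2 := by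
      rw [div_le_iff₀ (by positivity)]; linarith
    have h3 : (∑ i, ‖lapMap a Y i‖ ^ 2) / (2 * lam) ≤ lam * E / 2 := by
      rw [div_le_iff₀ (by positivity)]
      have := mul_le_mul_of_nonneg_left hYq hlam0.le
      linarith
    rw [Finset.sum_add_distrib, ← Finset.mul_sum]
    simp only [mul_assoc c₄]
    rw [← Finset.mul_sum]
    gcongr
    exact h1.trans (mul_le_mul_of_nonneg_left (by linarith) hα.le)
  have hsum2 : ∑ i, 2 * inner ℝ (X i) (-(α • lapMap a (fun j => X j - Y j) i)) =
      -(2 * α) * (q - r) := by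
    simp only [lapMap_sub, inner_neg_right, inner_smul_right, inner_sub_right]
    rw [hqdef, hrdef, ← Finset.sum_sub_distrib, Finset.mul_sum]
    exact Finset.sum_congr rfl fun i _ => by ring
  have hvs : ∑ i, v i ≤ c₄ * E := by
    rw [hEdef, Finset.mul_sum]
    exact Finset.sum_le_sum fun i _ => hv i
  rw [hsum2]
  have hcα : 0 < c₄ * α := mul_pos hc₄ hα
  have k1 : α * l / 2 * (∑ i, v i) ≤ α * lam / 2 * (c₄ * E) := by
    have := mul_nonneg hc₄.le hE
    calc _ ≤ α * l / 2 * (c₄ * E) := by gcongr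
      _ ≤ _ := by gcongr
  have k2 : c₄ * α * (l * D) ≤ c₄ * α * q := mul_le_mul_of_nonneg_left hXq hcα.le
  have k3 : c₄ * α * (2 * r) ≤ c₄ * α * (q + lam * E) :=
    mul_le_mul_of_nonneg_left (by linarith) hcα.le
  have k4 := mul_le_mul_of_nonneg_right hgain hE
  -- In units of `c₄ α`, the `q` terms are `1/2 - 2 + 1 = -1/2`, which pays for the decay of `D`.
  -- The `lam * E` terms are `3/2 + 1`, plus `1/2` from `∑ v`; the total `3` is the constant in
  -- `hgain`.
  nlinarith [hsum1, k1, k2, k3, k4]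

end Laplacian

/-! ## Carathéodory solutions -/

section Solves

variable {E : Type*} [NormedAddCommGroup E] [NormedSpace ℝ E] {t₀ : ℝ} {u v : ℝ → E}

theorem SolvesFrom.sub_eq_integral (h : SolvesFrom t₀ u v) {s t : ℝ} (hs : t₀ ≤ s) (ht : t₀ ≤ t) :
    u t - u s = ∫ r in s..t, v r := by
  rw [(h t ht).2, (h s hs).2, ← intervalIntegral.integral_interval_sub_left (h t ht).1 (h s hs).1]
  abel

theorem SolvesFrom.lipschitzOnWith (h : SolvesFrom t₀ u v) {T : ℝ} {M : NNReal}
    (hM : ∀ t ∈ Icc t₀ T, ‖v t‖ ≤ M) : LipschitzOnWith M u (Icc t₀ T) := by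
  refine LipschitzOnWith.of_dist_le_mul fun t ht s hs => ?_
  rw [dist_eq_norm, h.sub_eq_integral hs.1 ht.1, Real.dist_eq]
  refine intervalIntegral.norm_integral_le_of_norm_le_const fun r hr => hM r ?_
  exact uIcc_subset_Icc hs ht (uIoc_subset_uIcc hr)

theorem SolvesFrom.continuousOn (h : SolvesFrom t₀ u v) : ContinuousOn u (Ici t₀) := by
  intro t ht
  have hT : t₀ ≤ t + 1 := by have : t₀ ≤ t := ht; linarith
  have h1 : ContinuousOn (fun s => u t₀ + ∫ r in t₀..s, v r) (Icc t₀ (t + 1)) :=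
    continuousOn_const.add (by
      have := intervalIntegral.continuousOn_primitive_interval' (h _ hT).1 left_mem_uIcc
      rwa [uIcc_of_le hT] at this)
  have h2 : ContinuousOn u (Icc t₀ (t + 1)) := h1.congr fun s hs => (h s hs.1).2
  refine (h2 t ⟨ht, by linarith⟩).mono_of_mem_nhdsWithin ?_
  exact Filter.mem_of_superset (inter_mem_nhdsWithin (Ici t₀) (Iic_mem_nhds (by linarith)))
    fun s hs => ⟨hs.1, hs.2⟩

theorem SolvesFrom.ae_hasDerivAt [CompleteSpace E] (h : SolvesFrom t₀ u v) :
    ∀ᵐ t, t₀ < t → HasDerivAt u (v t) t := by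
  have h1 : ∀ N : ℕ, ∀ᵐ t, t ∈ uIcc t₀ (t₀ + N) → ∀ c ∈ uIcc t₀ (t₀ + N),
      HasDerivAt (fun x => ∫ s in c..x, v s) (v t) t := fun N =>
    (h (t₀ + N) (by simp)).1.ae_hasDerivAt_integral
  filter_upwards [ae_all_iff.2 h1] with t ht htt
  obtain ⟨N, hN⟩ := exists_nat_ge (t - t₀)
  have h2 := ht N (by rw [uIcc_of_le (by simp)]; exact ⟨htt.le, by linarith⟩) t₀ left_mem_uIcc
  refine (h2.const_add (u t₀)).congr_of_eventuallyEq ?_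
  filter_upwards [Ioi_mem_nhds htt] with s hs
  exact (h s (le_of_lt hs)).2

end Solves

/-- A differential inequality `W' ≤ -ρ W`, valid almost everywhere, gives exponential decay of an
absolutely continuous function. -/
theorem le_exp_mul_of_ae_deriv_le {W : ℝ → ℝ} {ρ : ℝ}
    (hW : ∀ T, 0 ≤ T → AbsolutelyContinuousOnInterval W 0 T)
    (hd : ∀ᵐ t, 0 < t → ∃ W', HasDerivAt W W' t ∧ W' ≤ -ρ * W t) {T : ℝ} (hT : 0 ≤ T) :
    W T ≤ W 0 * Real.exp (-ρ * T) := by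
  have hexp : ContDiff ℝ 1 (fun t : ℝ => Real.exp (ρ * t)) := by fun_prop
  have hac : AbsolutelyContinuousOnInterval (fun t => Real.exp (ρ * t) * W t) 0 T :=
    AbsolutelyContinuousOnInterval.mul
      (f := fun t => Real.exp (ρ * t)) (g := W)
      hexp.contDiffOn.absolutelyContinuousOnInterval (hW T hT)
  -- With the integrating factor the derivative is nonpositive almost everywhere; absolute
  -- continuity turns this into monotonicity between the endpoints.
  have hle : ∫ t in (0 : ℝ)..T, deriv (fun t => Real.exp (ρ * t) * W t) t ≤ 0 := by
    rw [intervalIntegral.integral_of_le hT]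
    refine integral_nonpos_of_ae ?_
    filter_upwards [ae_restrict_of_ae hd, ae_restrict_mem measurableSet_Ioc] with t ht htm
    obtain ⟨W', hW', hle⟩ := ht htm.1
    have h1 : HasDerivAt (fun t => Real.exp (ρ * t)) (Real.exp (ρ * t) * ρ) t := by
      simpa using ((hasDerivAt_id t).const_mul ρ).exp
    rw [(h1.fun_mul hW').deriv]
    have := mul_le_mul_of_nonneg_left hle (Real.exp_pos (ρ * t)).le
    simp only [Pi.zero_apply]
    linarith
  rw [hac.integral_deriv_eq_sub] at hle
  simp only [mul_zero, Real.exp_zero, one_mul] at hle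
  have h2 : Real.exp (ρ * T) * W T ≤ W 0 := by linarith
  have h3 := mul_le_mul_of_nonneg_right h2 (Real.exp_pos (-ρ * T)).le
  have h4 : Real.exp (ρ * T) * Real.exp (-ρ * T) = 1 := by
    rw [← Real.exp_add]; simp
  calc W T = Real.exp (ρ * T) * Real.exp (-ρ * T) * W T := by rw [h4, one_mul]
    _ = Real.exp (ρ * T) * W T * Real.exp (-ρ * T) := by ring
    _ ≤ _ := h3

theorem AbsolutelyContinuousOnInterval.finset_sum {ι : Type*} {f : ι → ℝ → ℝ} {a b : ℝ}
    (s : Finset ι) (h : ∀ i ∈ s, AbsolutelyContinuousOnInterval (f i) a b) :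
    AbsolutelyContinuousOnInterval (fun t => ∑ i ∈ s, f i t) a b := by
  classical
  induction s using Finset.induction_on with
  | empty => simpa using (LipschitzWith.const (0 : ℝ)).lipschitzOnWith.absolutelyContinuousOnInterval
  | insert i s hi ih =>
    simp only [Finset.sum_insert hi]
    exact (h i (Finset.mem_insert_self i s)).add
      (ih fun j hj => h j (Finset.mem_insert_of_mem hj))

/-- A `C¹` function of `(y, t)`, `t ≥ 0`, along a Lipschitz curve is absolutely continuous. -/
theorem ContDiffOn.absolutelyContinuousOnInterval_comp {E : Type*} [NormedAddCommGroup E]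
    [NormedSpace ℝ E] [ProperSpace E] {V : E → ℝ → ℝ}
    (hV : ContDiffOn ℝ 1 (fun p : E × ℝ => V p.1 p.2) (univ ×ˢ Ici (0 : ℝ)))
    {u : ℝ → E} {T : ℝ} (hT : 0 ≤ T) {M : NNReal} (hu : LipschitzOnWith M u (Icc 0 T)) :
    AbsolutelyContinuousOnInterval (fun t => V (u t) t) 0 T := by
  obtain ⟨R, hR⟩ := (isCompact_Icc.image_of_continuousOn hu.continuousOn).isBounded.subset_closedBall 0
  have hsub : Metric.closedBall (0 : E) R ×ˢ Icc 0 T ⊆ univ ×ˢ Ici (0 : ℝ) :=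
    prod_mono (subset_univ _) Icc_subset_Ici_self
  obtain ⟨K, hK⟩ := (hV.mono hsub).exists_lipschitzOnWith (by simp)
    ((convex_closedBall _ _).prod (convex_Icc _ _))
    ((isCompact_closedBall _ _).prod isCompact_Icc)
  have hpair : LipschitzOnWith (max M 1) (fun t => (u t, t)) (Icc 0 T) :=
    hu.prodMk LipschitzWith.id.lipschitzOnWith
  have := hK.comp hpair fun t ht => ⟨hR (mem_image_of_mem _ ht), ht⟩
  rw [← uIcc_of_le hT] at this
  exact this.absolutelyContinuousOnInterval

/-! ### Lyapunov functions along perturbed trajectories -/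

namespace IsLyapunovFor

variable {d : ℕ} {C : EuclideanSpace ℝ (Fin d) → ℝ → EuclideanSpace ℝ (Fin d)}
  {V : EuclideanSpace ℝ (Fin d) → ℝ → ℝ} {c₁ c₂ c₃ c₄ : ℝ}

theorem nonneg (h : IsLyapunovFor C V c₁ c₂ c₃ c₄) (y) {t : ℝ} (ht : 0 ≤ t) : 0 ≤ V y t :=
  le_trans (mul_nonneg h.c₁_pos.le (sq_nonneg _)) (h.lower y t ht)

theorem differentiable_state (h : IsLyapunovFor C V c₁ c₂ c₃ c₄) {t : ℝ} (ht : 0 ≤ t) :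
    Differentiable ℝ fun z => V z t := by
  have h1 : ContDiffOn ℝ 1 (fun z => V z t) univ :=
    h.contDiff.comp (f := fun z : EuclideanSpace ℝ (Fin d) => (z, t))
      (by fun_prop) fun z _ => ⟨mem_univ _, ht⟩
  exact (contDiffOn_univ.1 h1).differentiable (by simp)

/-- Mean value inequality along the segment from the origin, where `V` vanishes. It lets `c₄` play
the role of `c₂`, so that `c₂` enters neither the gain condition nor the rate. -/
theorem le_gradient_mul (h : IsLyapunovFor C V c₁ c₂ c₃ c₄) (y) {t : ℝ} (ht : 0 ≤ t) :
    V y t ≤ c₄ * ‖y‖ ^ 2 := by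
  have h0 : V 0 t = 0 := by
    have h1 := h.lower 0 t ht
    have h2 := h.upper 0 t ht
    simp at h1 h2
    linarith
  have := (convex_closedBall (0 : EuclideanSpace ℝ (Fin d)) ‖y‖).norm_image_sub_le_of_norm_fderiv_le
    (f := fun z => V z t) (C := c₄ * ‖y‖) (𝕜 := ℝ) (x := 0) (y := y)
    (fun z _ => h.differentiable_state ht z)
    (fun z hz => (h.gradient z t ht).trans (mul_le_mul_of_nonneg_left (by simpa using hz)
      h.c₄_pos.le)) (by simp) (by simp)
  rw [h0, sub_zero, sub_zero, Real.norm_eq_abs] at this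
  calc V y t ≤ |V y t| := le_abs_self _
    _ ≤ _ := this
    _ = _ := by ring

/-- Chain rule: the unperturbed part of the velocity is covered by `decay`, and the perturbation `w`
costs at most the gradient bound times `‖w‖`. -/
theorem exists_hasDerivAt (h : IsLyapunovFor C V c₁ c₂ c₃ c₄) {u : ℝ → EuclideanSpace ℝ (Fin d)}
    {w : EuclideanSpace ℝ (Fin d)} {t : ℝ} (ht : 0 < t) (hu : HasDerivAt u (-C (u t) t + w) t) :
    ∃ W', HasDerivAt (fun s => V (u s) s) W' t ∧ W' ≤ -c₃ * ‖u t‖ ^ 2 + c₄ * ‖u t‖ * ‖w‖ := by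
  have hnhds : univ ×ˢ Ici (0 : ℝ) ∈ 𝓝 (u t, t) := prod_mem_nhds univ_mem (Ici_mem_nhds ht)
  have hF : HasFDerivAt (fun p : EuclideanSpace ℝ (Fin d) × ℝ => V p.1 p.2) _ (u t, t) :=
    ((h.contDiff.contDiffAt hnhds).differentiableAt (by simp)).hasFDerivAt
  set D := fderiv ℝ (fun p : EuclideanSpace ℝ (Fin d) × ℝ => V p.1 p.2) (u t, t)
  have hcomp : HasDerivAt (fun s => V (u s) s) (D (-C (u t) t + w, 1)) t :=
    hF.comp_hasDerivAt (f := fun s => (u s, s)) t (hu.prodMk (hasDerivAt_id t))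
  have hy : HasFDerivAt (fun z => V z t) (D.comp (ContinuousLinearMap.inl ℝ _ ℝ)) (u t) := by
    exact hF.comp (f := fun z => (z, t)) (u t) (hasFDerivAt_prodMk_left (u t) t)
  have hs : HasDerivAt (fun s => V (u t) s) (D (0, 1)) t :=
    hF.comp_hasDerivAt (f := fun s => (u t, s)) t ((hasDerivAt_const t (u t)).prodMk (hasDerivAt_id t))
  have hdec := h.decay (u t) t ht.le
  have hgr := h.gradient (u t) t ht.le
  rw [hy.fderiv] at hdec hgr
  rw [hs.hasDerivWithinAt.derivWithin (uniqueDiffOn_Ici 0 t ht.le)] at hdec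
  set D₁ := D.comp (ContinuousLinearMap.inl ℝ (EuclideanSpace ℝ (Fin d)) ℝ)
  have hsplit : D (-C (u t) t + w, 1) = D (0, 1) - D₁ (C (u t) t) + D₁ w := by
    have : ((-C (u t) t + w, 1) : EuclideanSpace ℝ (Fin d) × ℝ) =
        (0, 1) - (C (u t) t, 0) + (w, 0) := by
      ext <;> simp
    rw [this, map_add, map_sub]
    rfl
  refine ⟨_, hcomp, ?_⟩
  rw [hsplit]
  have h1 : D₁ w ≤ c₄ * ‖u t‖ * ‖w‖ :=
    (le_abs_self _).trans ((D₁.le_opNorm w).trans (mul_le_mul_of_nonneg_right hgr (norm_nonneg _)))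
  linarith

end IsLyapunovFor

/-! ### Consensus along the observer-based flow -/

section Flow

variable {n d : ℕ} {G : SimpleGraph (Fin n)} {a : Matrix (Fin n) (Fin n) ℝ}
  {C : EuclideanSpace ℝ (Fin d) → ℝ → EuclideanSpace ℝ (Fin d)} {α : ℝ}
  {x : Fin n → ℝ → EuclideanSpace ℝ (Fin d)} {xh : Fin n → Fin n → ℝ → EuclideanSpace ℝ (Fin d)}

theorem mem_nbrs {i j : Fin n} : j ∈ nbrs a i ↔ laplacian a i j ≠ 0 := by
  simp [nbrs]

/-- A connected graph on at least two vertices has no isolated vertex, so every diagonal entry is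
positive. Hence each agent stores an estimate of its own state. -/
theorem IsWeightMatrix.self_mem_nbrs (ha : IsWeightMatrix G a) (hG : G.Connected) (hn : 2 ≤ n)
    (i : Fin n) : i ∈ nbrs a i := by
  classical
  have : Nontrivial (Fin n) := Fin.nontrivial_iff_two_le.2 hn
  obtain ⟨j, hj⟩ := (G.degree_pos_iff_exists_adj i).1 (hG.preconnected.degree_pos_of_nontrivial i)
  rw [mem_nbrs]
  have : 0 < ∑ k, a i k := Finset.sum_pos' (fun k _ => ha.nonneg i k) ⟨j, Finset.mem_univ _, ha.pos i j hj⟩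
  simpa [laplacian] using this.ne'

/-- The right-hand side of the observer for `j` does not depend on the agent `i` that runs it, so
equal initial values give equal estimates. -/
theorem IsDCOCFlow.observer_eq (h : IsDCOCFlow a C α x xh) (ha : IsWeightMatrix G a)
    (hself : ∀ i, i ∈ nbrs a i) {i j : Fin n} (hj : j ∈ nbrs a i) {t : ℝ} (ht : 0 ≤ t) :
    xh i j t = xh j j t := by
  have hi : i ∈ nbrs a j := by
    rw [mem_nbrs] at hj ⊢
    rwa [laplacian_symm_apply ha.symm]
  rw [(h.observer i j hj t ht).2, (h.observer j j (hself j) t ht).2,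
    h.init j i hi j (hself j)]

theorem IsDCOCFlow.input_eq (h : IsDCOCFlow a C α x xh) (ha : IsWeightMatrix G a)
    (hself : ∀ i, i ∈ nbrs a i) (i : Fin n) {t : ℝ} (ht : 0 ≤ t) :
    -(α • ∑ j ∈ nbrs a i, laplacian a i j • xh i j t) =
      -(α • lapMap a (fun j => xh j j t) i) := by
  congr 2
  rw [Finset.sum_congr rfl fun j hj => by rw [h.observer_eq ha hself hj ht], lapMap]
  refine Finset.sum_subset (Finset.subset_univ _) fun j _ hj => ?_
  rw [mem_nbrs, not_not] at hj
  rw [hj, zero_smul]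

theorem IsDCOCFlow.sum_state (h : IsDCOCFlow a C α x xh) (ha : IsWeightMatrix G a)
    (hself : ∀ i, i ∈ nbrs a i) {t : ℝ} (ht : 0 ≤ t) : ∑ i, x i t = ∑ i, x i 0 := by
  rw [Finset.sum_congr rfl fun i _ => (h.state i t ht).2, Finset.sum_add_distrib,
    ← intervalIntegral.integral_finsetSum fun i _ => (h.state i t ht).1]
  have : ∀ s ∈ uIcc 0 t,
      ∑ i, -(α • ∑ j ∈ nbrs a i, laplacian a i j • xh i j s) = 0 := by
    intro s hs
    rw [uIcc_of_le ht] at hs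
    rw [Finset.sum_congr rfl fun i _ => h.input_eq ha hself i hs.1, Finset.sum_neg_distrib,
      ← Finset.smul_sum, sum_lapMap ha, smul_zero, neg_zero]
  rw [intervalIntegral.integral_congr this]
  simp

/-- States and estimates are continuous, hence bounded on `[0, T]`; the linear growth of `C` then
bounds the velocities without any continuity of `C`. -/
theorem IsDCOCFlow.exists_lipschitz (h : IsDCOCFlow a C α x xh) (ha : IsWeightMatrix G a)
    (hself : ∀ i, i ∈ nbrs a i) {Lc : ℝ} (hLc : 0 ≤ Lc) (hC : ∀ y t, 0 ≤ t → ‖C y t‖ ≤ Lc * ‖y‖)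
    (i : Fin n) (T : ℝ) :
    (∃ M, LipschitzOnWith M (x i) (Icc 0 T)) ∧
      ∃ M, LipschitzOnWith M (fun t => x i t - xh i i t) (Icc 0 T) := by
  have cx : ∀ j, ContinuousOn (x j) (Icc 0 T) := fun j =>
    (h.state j).continuousOn.mono Icc_subset_Ici_self
  have cxh : ∀ j, ContinuousOn (xh j j) (Icc 0 T) := fun j =>
    (h.observer j j (hself j)).continuousOn.mono Icc_subset_Ici_self
  have h1 : ∃ M, LipschitzOnWith M (x i) (Icc 0 T) := by
    have hc : ContinuousOn (fun t => -(α • lapMap a (fun j => xh j j t) i)) (Icc 0 T) := by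
      unfold lapMap
      fun_prop
    obtain ⟨M, hM⟩ := isCompact_Icc.exists_bound_of_continuousOn hc
    refine ⟨M.toNNReal, (h.state i).lipschitzOnWith fun t ht => ?_⟩
    rw [h.input_eq ha hself i ht.1]
    exact (hM t ht).trans (Real.le_coe_toNNReal M)
  have h2 : ∃ M, LipschitzOnWith M (xh i i) (Icc 0 T) := by
    obtain ⟨M, hM⟩ := isCompact_Icc.exists_bound_of_continuousOn ((cx i).sub (cxh i))
    refine ⟨(Lc * M).toNNReal, (h.observer i i (hself i)).lipschitzOnWith fun t ht => ?_⟩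
    exact ((hC _ t ht.1).trans (mul_le_mul_of_nonneg_left (hM t ht) hLc)).trans
      (Real.le_coe_toNNReal _)
  obtain ⟨M, hM⟩ := h1
  obtain ⟨M', hM'⟩ := h2
  exact ⟨⟨M, hM⟩, ⟨M + M', hM.sub hM'⟩⟩

/-- The consensus error of the observer-based compressed flow decays at rate `α λ₂ / 2`. -/
theorem IsDCOCFlow.isBigO (h : IsDCOCFlow a C α x xh) (ha : IsWeightMatrix G a)
    (hn : 2 ≤ n) (hself : ∀ i, i ∈ nbrs a i) {Lc : ℝ} (hLc : 0 ≤ Lc)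
    (hC : ∀ y t, 0 ≤ t → ‖C y t‖ ≤ Lc * ‖y‖)
    {V : EuclideanSpace ℝ (Fin d) → ℝ → ℝ} {c₁ c₂ c₃ c₄ : ℝ} (hV : IsLyapunovFor C V c₁ c₂ c₃ c₄)
    {lam : ℝ} (hlam : ∀ k, lapEigenvalue ha.symm k ≤ lam) (hlam0 : 0 < lam)
    (hα : 0 < α) (hgain : 3 * (α * lam * c₄) ≤ c₃) (i : Fin n) :
    (fun t => ‖x i t - (1 / (n : ℝ)) • ∑ j, x j 0‖ ^ 2) =O[atTop]
      fun t => Real.exp (-(α * lapEigenvalue ha.symm ⟨1, hn⟩ / 2) * t) := by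
  set m := (1 / (n : ℝ)) • ∑ j, x j 0 with hm
  set ρ := α * lapEigenvalue ha.symm ⟨1, hn⟩ / 2
  have hn0 : (n : ℝ) ≠ 0 := by positivity
  -- The weight `c₄` matches the cross term `c₄ ‖Y‖ ‖X'‖` produced by differentiating `V`.
  set W : ℝ → ℝ := fun t => ∑ j, V (x j t - xh j j t) t + c₄ * ∑ j, ‖x j t - m‖ ^ 2 with hW
  have hsum0 : ∀ t, 0 ≤ t → ∑ j, (x j t - m) = 0 := by
    intro t ht
    rw [Finset.sum_sub_distrib, h.sum_state ha hself ht, hm, Finset.sum_const, Finset.card_univ,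
      Fintype.card_fin, ← Nat.cast_smul_eq_nsmul ℝ, smul_smul]
    field_simp
    simp
  have hac : ∀ T, 0 ≤ T → AbsolutelyContinuousOnInterval W 0 T := by
    intro T hT
    refine AbsolutelyContinuousOnInterval.add (AbsolutelyContinuousOnInterval.finset_sum _ fun j _ => ?_)
      (AbsolutelyContinuousOnInterval.const_mul c₄
        (AbsolutelyContinuousOnInterval.finset_sum _ fun j _ => ?_))
    · obtain ⟨M, hM⟩ := (h.exists_lipschitz ha hself hLc hC j T).2
      exact hV.contDiff.absolutelyContinuousOnInterval_comp hT hM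
    · obtain ⟨M, hM⟩ := (h.exists_lipschitz ha hself hLc hC j T).1
      have hsq : ContDiff ℝ 1 (fun p : EuclideanSpace ℝ (Fin d) × ℝ => ‖p.1 - m‖ ^ 2) :=
        (contDiff_fst.sub contDiff_const).norm_sq ℝ
      exact hsq.contDiffOn.absolutelyContinuousOnInterval_comp
        (V := fun y _ => ‖y - m‖ ^ 2) hT hM
  have hder : ∀ᵐ t, 0 < t → ∃ W', HasDerivAt W W' t ∧ W' ≤ -ρ * W t := by
    have hx := ae_all_iff.2 fun j => (h.state j).ae_hasDerivAt
    have hxh := ae_all_iff.2 fun j => (h.observer j j (hself j)).ae_hasDerivAt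
    filter_upwards [hx, hxh] with t hxt hxht ht
    -- The estimates are `X - Y` shifted by the constant `m`, and the Laplacian kills constants.
    have hlap : ∀ j, lapMap a (fun k => xh k k t) j =
        lapMap a (fun k => (x k t - m) - (x k t - xh k k t)) j := by
      intro j
      have : (fun k => (x k t - m) - (x k t - xh k k t)) = fun k => xh k k t - m := by
        funext k; abel
      rw [this, lapMap_sub, lapMap_const ha.diag, sub_zero]
    have hx' : ∀ j, HasDerivAt (x j)
        (-(α • lapMap a (fun k => (x k t - m) - (x k t - xh k k t)) j)) t := by
      intro j
      have := hxt j ht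
      rwa [h.input_eq ha hself j ht.le, hlap] at this
    have he : ∀ j, HasDerivAt (fun s => x j s - xh j j s) (-C (x j t - xh j j t) t +
        -(α • lapMap a (fun k => (x k t - m) - (x k t - xh k k t)) j)) t := by
      intro j
      rw [add_comm, ← sub_eq_add_neg]
      exact (hx' j).sub (hxht j ht)
    choose V' hV' hV'le using fun j => hV.exists_hasDerivAt ht (he j)
    refine ⟨_, (HasDerivAt.fun_sum fun j _ => hV' j).add ((HasDerivAt.fun_sum fun j _ =>
      ((hx' j).sub_const m).norm_sq).const_mul c₄), ?_⟩
    refine le_trans ?_ (ha.dissipation_estimate hn hlam hlam0 hV.c₄_pos hα hgain (hsum0 t ht.le)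
      (fun j => hV.le_gradient_mul (x j t - xh j j t) ht.le))
    exact add_le_add (Finset.sum_le_sum fun j _ => hV'le j) le_rfl
  have hdecay : ∀ t, 0 ≤ t → W t ≤ W 0 * Real.exp (-ρ * t) := fun t ht =>
    le_exp_mul_of_ae_deriv_le hac hder ht
  refine IsBigO.of_bound (W 0 / c₄) ?_
  filter_upwards [eventually_ge_atTop 0] with t ht
  rw [Real.norm_of_nonneg (sq_nonneg _), Real.norm_of_nonneg (Real.exp_pos _).le, div_mul_eq_mul_div,
    le_div_iff₀ hV.c₄_pos]
  refine le_trans ?_ (hdecay t ht)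
  have h1 : ‖x i t - m‖ ^ 2 ≤ ∑ j, ‖x j t - m‖ ^ 2 :=
    Finset.single_le_sum (f := fun j => ‖x j t - m‖ ^ 2) (fun j _ => sq_nonneg _) (Finset.mem_univ i)
  have h2 : 0 ≤ ∑ j, V (x j t - xh j j t) t := Finset.sum_nonneg fun j _ => hV.nonneg _ ht
  have h3 := mul_le_mul_of_nonneg_left h1 hV.c₄_pos.le
  simp only [hW]
  linarith

end Flow

/-! ## Parametric integrals of `C¹` functions -/

section Parametric

variable {Q F : Type*} [NormedAddCommGroup Q] [NormedSpace ℝ Q] [ProperSpace Q]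
  [NormedAddCommGroup F] [NormedSpace ℝ F]

/-- The partial derivative is continuous, hence bounded on the compact product of a closed ball and
the interval; this constant is the dominating function. -/
theorem hasFDerivAt_intervalIntegral_of_contDiff {h : Q → ℝ → F}
    (hh : ContDiff ℝ 1 (fun p : Q × ℝ => h p.1 p.2)) (a b : ℝ) (q : Q) :
    HasFDerivAt (fun q => ∫ s in a..b, h q s)
      (∫ s in a..b, (fderiv ℝ (fun p : Q × ℝ => h p.1 p.2) (q, s)).comp
        (ContinuousLinearMap.inl ℝ Q ℝ)) q := by
  set D : Q → ℝ → Q →L[ℝ] F := fun q s => (fderiv ℝ (fun p : Q × ℝ => h p.1 p.2) (q, s)).comp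
    (ContinuousLinearMap.inl ℝ Q ℝ)
  have hDc : Continuous (fun p : Q × ℝ => D p.1 p.2) :=
    (hh.continuous_fderiv (by simp)).clm_comp continuous_const
  obtain ⟨M, hM⟩ := ((isCompact_closedBall q 1).prod (isCompact_uIcc (a := a) (b := b))).exists_bound_of_continuousOn
    hDc.continuousOn
  refine intervalIntegral.hasFDerivAt_integral_of_dominated_of_fderiv_le (F' := D)
    (bound := fun _ => M) (Metric.closedBall_mem_nhds q one_pos) ?_ ?_ ?_ ?_ ?_ ?_
  · exact Eventually.of_forall fun p =>
      (hh.continuous.comp (Continuous.prodMk_right p)).aestronglyMeasurable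
  · exact (hh.continuous.comp (Continuous.prodMk_right q)).intervalIntegrable _ _
  · exact (hDc.comp (Continuous.prodMk_right q)).aestronglyMeasurable
  · exact Eventually.of_forall fun s hs p hp => hM (p, s) ⟨hp, uIoc_subset_uIcc hs⟩
  · exact intervalIntegrable_const
  · refine Eventually.of_forall fun s _ p _ => ?_
    exact ((hh.differentiable (by simp)) (p, s)).hasFDerivAt.comp (f := fun p => (p, s)) p
      (hasFDerivAt_prodMk_left p s)

theorem contDiff_intervalIntegral_of_contDiff {h : Q → ℝ → F}
    (hh : ContDiff ℝ 1 (fun p : Q × ℝ => h p.1 p.2)) (a b : ℝ) :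
    ContDiff ℝ 1 (fun q => ∫ s in a..b, h q s) := by
  rw [contDiff_one_iff_hasFDerivAt]
  refine ⟨_, ?_, hasFDerivAt_intervalIntegral_of_contDiff hh a b⟩
  refine intervalIntegral.continuous_parametric_intervalIntegral_of_continuous' ?_ a b
  exact (hh.continuous_fderiv (by simp)).clm_comp continuous_const

theorem fderiv_intervalIntegral_apply [CompleteSpace F] {h : Q → ℝ → F}
    (hh : ContDiff ℝ 1 (fun p : Q × ℝ => h p.1 p.2)) (a b : ℝ) (q w : Q) :
    fderiv ℝ (fun q => ∫ s in a..b, h q s) q w =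
      ∫ s in a..b, fderiv ℝ (fun p : Q × ℝ => h p.1 p.2) (q, s) (w, 0) := by
  rw [(hasFDerivAt_intervalIntegral_of_contDiff hh a b q).fderiv,
    ContinuousLinearMap.intervalIntegral_apply]
  · rfl
  · exact (((hh.continuous_fderiv (by simp)).comp (Continuous.prodMk_right q)).clm_comp
      continuous_const).intervalIntegrable _ _

/-- Serves the Picard inductions, where the majorant of the next iterate is obtained by integrating
that of the previous one. -/
theorem norm_integral_le_sub_of_hasDerivAt {u : ℝ → F} {g G : ℝ → ℝ} {r : ℝ} (hr : 0 ≤ r)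
    (hg : Continuous g) (hG : ∀ s, HasDerivAt G (g s) s) (hu : ∀ s ∈ Icc 0 r, ‖u s‖ ≤ g s) :
    ‖∫ s in (0 : ℝ)..r, u s‖ ≤ G r - G 0 := by
  rw [← intervalIntegral.integral_eq_sub_of_hasDerivAt (fun s _ => hG s)
    (hg.intervalIntegrable _ _)]
  exact intervalIntegral.norm_integral_le_of_norm_le hr
    (Eventually.of_forall fun s hs => hu s (Ioc_subset_Icc_self hs)) (hg.intervalIntegrable _ _)

end Parametric

/-! ## Reflection of a time-dependent vector field -/

/-- The odd reflection about `t = 0` of a vector field on `t ≥ 0`. -/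
noncomputable def reflectTime {E : Type*} [AddCommGroup E] (f : E → ℝ → E) (y : E) (t : ℝ) : E :=
  f y (max t 0) - f y (max (-t) 0) + f y 0

theorem reflectTime_of_nonneg {E : Type*} [AddCommGroup E] (f : E → ℝ → E) (y : E) {t : ℝ}
    (ht : 0 ≤ t) : reflectTime f y t = f y t := by
  simp [reflectTime, ht]

theorem contDiff_reflectTime {E : Type*} [NormedAddCommGroup E] [NormedSpace ℝ E] {f : E → ℝ → E}
    (hf : ContDiffOn ℝ 1 (fun p : E × ℝ => f p.1 p.2) (univ ×ˢ Ici (0 : ℝ))) :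
    ContDiff ℝ 1 (fun p : E × ℝ => reflectTime f p.1 p.2) := by
  set s : Set (E × ℝ) := univ ×ˢ Ici (0 : ℝ)
  set s' : Set (E × ℝ) := univ ×ˢ Iic (0 : ℝ)
  set F : E × ℝ → E := fun p => f p.1 p.2
  set D := fderivWithin ℝ F s
  have hs : UniqueDiffOn ℝ s := uniqueDiffOn_univ.prod (uniqueDiffOn_Ici 0)
  have hDc : ContinuousOn D s := hf.continuousOn_fderivWithin hs (by simp)
  have hF : ∀ p ∈ s, HasFDerivWithinAt F (D p) s p := fun p hp =>
    ((hf.differentiableOn (by simp)) p hp).hasFDerivWithinAt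
  set R : E × ℝ →L[ℝ] E × ℝ := (ContinuousLinearMap.fst ℝ E ℝ).prod (-ContinuousLinearMap.snd ℝ E ℝ)
  set P : E × ℝ →L[ℝ] E × ℝ := (ContinuousLinearMap.fst ℝ E ℝ).prod 0
  -- One continuous formula for both half-spaces. For `t ≥ 0` the last two summands cancel by `hPR`
  -- and leave `D p`; for `t ≤ 0` the outer terms cancel and leave the derivative of `2 F ∘ P - F ∘
  -- R`.
  set D' : E × ℝ → E × ℝ →L[ℝ] E := fun p => D (p.1, max p.2 0) +
    ((2 : ℝ) • (D (p.1, 0)).comp P - (D (p.1, max (-p.2) 0)).comp R) - D (p.1, 0)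
  have hPR : ∀ A : E × ℝ →L[ℝ] E, (2 : ℝ) • A.comp P - A.comp R = A := by
    intro A
    ext v
    · simp [P, R, two_smul]
    · have : A (0, -1) = -A (0, 1) := by rw [← map_neg]; simp
      simp [P, R, this]
      exact map_zero A
  rw [contDiff_one_iff_hasFDerivAt]
  refine ⟨D', ?_, fun p => ?_⟩
  · have h1 : Continuous fun p : E × ℝ => D (p.1, max p.2 0) :=
      hDc.comp_continuous (by fun_prop) fun p =>
        ⟨mem_univ _, show 0 ≤ max p.2 0 from le_max_right _ _⟩
    have h2 : Continuous fun p : E × ℝ => D (p.1, max (-p.2) 0) :=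
      hDc.comp_continuous (by fun_prop) fun p =>
        ⟨mem_univ _, show 0 ≤ max (-p.2) 0 from le_max_right _ _⟩
    have h3 : Continuous fun p : E × ℝ => D (p.1, (0 : ℝ)) :=
      hDc.comp_continuous (by fun_prop) fun p => ⟨mem_univ _, le_refl (0 : ℝ)⟩
    have h4 : Continuous fun p : E × ℝ => (D (p.1, (0 : ℝ))).comp P :=
      h3.clm_comp continuous_const
    have h5 : Continuous fun p : E × ℝ => (D (p.1, max (-p.2) 0)).comp R :=
      h2.clm_comp continuous_const
    have h6 : Continuous fun p : E × ℝ => (2 : ℝ) • (D (p.1, (0 : ℝ))).comp P := by fun_prop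
    exact (h1.add (h6.sub h5)).sub h3
  · have hpos : HasFDerivWithinAt (fun p : E × ℝ => reflectTime f p.1 p.2) (D' p) s p := by
      by_cases hp : p ∈ s
      · have hp2 : 0 ≤ p.2 := hp.2
        have hD' : D' p = D p := by
          simp only [D', max_eq_left hp2, max_eq_right (neg_nonpos.2 hp2), hPR]
          abel
        rw [hD']
        exact (hF p hp).congr (fun q hq => reflectTime_of_nonneg f _ hq.2)
          (reflectTime_of_nonneg f _ hp2)
      · refine HasFDerivWithinAt.of_notMem_closure ?_
        rwa [(isClosed_univ.prod isClosed_Ici).closure_eq]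
    have hneg : HasFDerivWithinAt (fun p : E × ℝ => reflectTime f p.1 p.2) (D' p) s' p := by
      by_cases hp : p ∈ s'
      · have hp2 : p.2 ≤ 0 := hp.2
        have hD' : D' p = (2 : ℝ) • (D (P p)).comp P - (D (R p)).comp R := by
          have h1 : P p = (p.1, 0) := rfl
          have h2 : R p = (p.1, -p.2) := rfl
          simp only [D', max_eq_right hp2, max_eq_left (neg_nonneg.2 hp2), h1, h2]
          abel
        have heq : ∀ q ∈ s', reflectTime f q.1 q.2 = (2 : ℝ) • F (P q) - F (R q) := by
          intro q hq
          have hq2 : q.2 ≤ 0 := hq.2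
          simp only [reflectTime, max_eq_right hq2, max_eq_left (neg_nonneg.2 hq2), two_smul]
          have h1 : F (P q) = f q.1 0 := rfl
          have h2 : F (R q) = f q.1 (-q.2) := rfl
          rw [h1, h2]
          abel
        rw [hD']
        refine HasFDerivWithinAt.congr ?_ heq (heq p hp)
        refine HasFDerivWithinAt.sub (HasFDerivWithinAt.const_smul ?_ _) ?_
        · exact (hF (P p) ⟨mem_univ _, le_refl (0 : ℝ)⟩).comp p P.hasFDerivWithinAt
            fun q _ => ⟨mem_univ _, le_refl (0 : ℝ)⟩
        · exact (hF (R p) ⟨mem_univ _, show 0 ≤ -p.2 from neg_nonneg.2 hp2⟩).comp p R.hasFDerivWithinAt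
            fun q hq => ⟨mem_univ _, show 0 ≤ -q.2 from neg_nonneg.2 hq.2⟩
      · refine HasFDerivWithinAt.of_notMem_closure ?_
        rwa [(isClosed_univ.prod isClosed_Iic).closure_eq]
    have := hpos.union hneg
    rw [← prod_union, union_comm, Iic_union_Ici, univ_prod_univ] at this
    exact hasFDerivWithinAt_univ.1 this

/-! ## Picard iterates -/

theorem norm_field_le {E : Type*} [NormedAddCommGroup E] {f : E → ℝ → E} {L : ℝ}
    (hlip : ∀ y z t, ‖f y t - f z t‖ ≤ L * ‖y - z‖) (h0 : ∀ t, f 0 t = 0)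
    (y : E) (t : ℝ) : ‖f y t‖ ≤ L * ‖y‖ := by
  simpa [h0] using hlip y 0 t

section Picard

variable {E : Type*} [NormedAddCommGroup E] [NormedSpace ℝ E]

/-- Picard iterates of `dy/dt = f (y, t)`: `picard f N (y, t, r)` approximates at time `t + r` the
solution that starts at `y` at time `t`. -/
noncomputable def picard (f : E → ℝ → E) : ℕ → E × ℝ × ℝ → E
  | 0, q => q.1
  | N + 1, q => q.1 + ∫ s in (0 : ℝ)..q.2.2, f (picard f N (q.1, q.2.1, s)) (q.2.1 + s)

variable {f : E → ℝ → E}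

theorem picard_succ (N : ℕ) (y : E) (t r : ℝ) :
    picard f (N + 1) (y, t, r) = y + ∫ s in (0 : ℝ)..r, f (picard f N (y, t, s)) (t + s) := rfl

theorem picard_zero_time (N : ℕ) (y : E) (t : ℝ) : picard f N (y, t, 0) = y := by
  cases N with
  | zero => rfl
  | succ N => simp [picard_succ]

theorem contDiff_picard [ProperSpace E] (hf : ContDiff ℝ 1 (fun p : E × ℝ => f p.1 p.2)) (N : ℕ) :
    ContDiff ℝ 1 (picard f N) := by
  induction N with
  | zero => exact contDiff_fst
  | succ N ih =>
    -- The substitution `s = r u` fixes the interval of integration, so smoothness in `r` becomes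
    -- smoothness in a parameter.
    have heq : picard f (N + 1) = fun q : E × ℝ × ℝ => q.1 + q.2.2 • ∫ u in (0 : ℝ)..1,
        f (picard f N (q.1, q.2.1, q.2.2 * u)) (q.2.1 + q.2.2 * u) := by
      funext q
      rw [intervalIntegral.smul_integral_comp_mul_left
        (fun s => f (picard f N (q.1, q.2.1, s)) (q.2.1 + s))]
      simp [picard]
    rw [heq]
    refine contDiff_fst.add (contDiff_snd.snd.smul (contDiff_intervalIntegral_of_contDiff
      (h := fun (q : E × ℝ × ℝ) u =>
        f (picard f N (q.1, q.2.1, q.2.2 * u)) (q.2.1 + q.2.2 * u)) ?_ 0 1))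
    have h1 : ContDiff ℝ 1 fun p : (E × ℝ × ℝ) × ℝ =>
        picard f N (p.1.1, p.1.2.1, p.1.2.2 * p.2) := ih.comp (by fun_prop)
    exact hf.comp (h1.prodMk (by fun_prop : ContDiff ℝ 1 fun p : (E × ℝ × ℝ) × ℝ =>
      p.1.2.1 + p.1.2.2 * p.2))

variable {L : ℝ}

theorem picard_zero_state (h0 : ∀ t, f 0 t = 0) (N : ℕ) (t r : ℝ) : picard f N (0, t, r) = 0 := by
  induction N generalizing r with
  | zero => rfl
  | succ N ih => simp [picard_succ, ih, h0]

variable [ProperSpace E]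

theorem continuous_picard_integrand (hf : ContDiff ℝ 1 (fun p : E × ℝ => f p.1 p.2)) (N : ℕ)
    (y : E) (t : ℝ) : Continuous fun s => f (picard f N (y, t, s)) (t + s) := by
  have h1 : Continuous fun s => picard f N (y, t, s) :=
    (contDiff_picard hf N).continuous.comp (by fun_prop)
  exact hf.continuous.comp (h1.prodMk (by fun_prop))

theorem hasDerivAt_exp_mul (L c s : ℝ) :
    HasDerivAt (fun s => Real.exp (L * s) * c) (L * (Real.exp (L * s) * c)) s := by
  have := (((hasDerivAt_id s).const_mul L).exp).mul_const c
  exact this.congr_deriv (by simp; ring)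

theorem hasDerivAt_pow_div_factorial (L c : ℝ) (N : ℕ) (s : ℝ) :
    HasDerivAt (fun s => (L * s) ^ (N + 1) / (N + 1).factorial * c)
      (L * ((L * s) ^ N / N.factorial * c)) s := by
  have := ((((hasDerivAt_id s).const_mul L).fun_pow (N + 1)).div_const
    ((N + 1).factorial : ℝ)).mul_const c
  refine this.congr_deriv ?_
  have h1 : ((N.factorial : ℝ)) ≠ 0 := by positivity
  have h2 : (N : ℝ) + 1 ≠ 0 := by positivity
  simp [Nat.factorial_succ]
  field_simp

theorem norm_picard_sub_le (hf : ContDiff ℝ 1 (fun p : E × ℝ => f p.1 p.2)) (hL : 0 ≤ L)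
    (hlip : ∀ y z t, ‖f y t - f z t‖ ≤ L * ‖y - z‖) (N : ℕ) (y z : E) (t : ℝ) {r : ℝ}
    (hr : 0 ≤ r) :
    ‖picard f N (y, t, r) - picard f N (z, t, r)‖ ≤ Real.exp (L * r) * ‖y - z‖ := by
  induction N generalizing r with
  | zero =>
    have : 1 ≤ Real.exp (L * r) := Real.one_le_exp (by positivity)
    exact le_mul_of_one_le_left (norm_nonneg _) this
  | succ N ih =>
    have h1 := norm_integral_le_sub_of_hasDerivAt
      (u := fun s => f (picard f N (y, t, s)) (t + s) - f (picard f N (z, t, s)) (t + s)) hr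
      (by fun_prop) (hasDerivAt_exp_mul L ‖y - z‖)
      fun s hs => (hlip _ _ _).trans (mul_le_mul_of_nonneg_left (ih hs.1) hL)
    rw [intervalIntegral.integral_sub ((continuous_picard_integrand hf N y t).intervalIntegrable _ _)
      ((continuous_picard_integrand hf N z t).intervalIntegrable _ _)] at h1
    rw [picard_succ, picard_succ, add_sub_add_comm]
    refine (norm_add_le _ _).trans ((add_le_add_right h1 _).trans (le_of_eq ?_))
    simp

theorem norm_picard_le (hf : ContDiff ℝ 1 (fun p : E × ℝ => f p.1 p.2)) (hL : 0 ≤ L)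
    (hlip : ∀ y z t, ‖f y t - f z t‖ ≤ L * ‖y - z‖) (h0 : ∀ t, f 0 t = 0) (N : ℕ) (y : E) (t : ℝ)
    {r : ℝ} (hr : 0 ≤ r) : ‖picard f N (y, t, r)‖ ≤ Real.exp (L * r) * ‖y‖ := by
  simpa [picard_zero_state h0] using norm_picard_sub_le hf hL hlip N y 0 t hr

theorem norm_picard_sub_self_le (hf : ContDiff ℝ 1 (fun p : E × ℝ => f p.1 p.2)) (hL : 0 ≤ L)
    (hlip : ∀ y z t, ‖f y t - f z t‖ ≤ L * ‖y - z‖) (h0 : ∀ t, f 0 t = 0) (N : ℕ) (y : E) (t : ℝ)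
    {r : ℝ} (hr : 0 ≤ r) : ‖picard f N (y, t, r) - y‖ ≤ (Real.exp (L * r) - 1) * ‖y‖ := by
  cases N with
  | zero =>
    have : 1 ≤ Real.exp (L * r) := Real.one_le_exp (by positivity)
    simpa [picard] using mul_nonneg (sub_nonneg.2 this) (norm_nonneg y)
  | succ N =>
    have h1 := norm_integral_le_sub_of_hasDerivAt
      (u := fun s => f (picard f N (y, t, s)) (t + s)) hr
      (by fun_prop) (hasDerivAt_exp_mul L ‖y‖)
      fun s hs => (norm_field_le hlip h0 _ _).trans
        (mul_le_mul_of_nonneg_left (norm_picard_le hf hL hlip h0 N y t hs.1) hL)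
    rw [picard_succ, add_sub_cancel_left]
    refine h1.trans (le_of_eq ?_)
    simp; ring

theorem norm_picard_succ_sub_le (hf : ContDiff ℝ 1 (fun p : E × ℝ => f p.1 p.2)) (hL : 0 ≤ L)
    (hlip : ∀ y z t, ‖f y t - f z t‖ ≤ L * ‖y - z‖) (h0 : ∀ t, f 0 t = 0) (N : ℕ) (y : E) (t : ℝ)
    {r : ℝ} (hr : 0 ≤ r) : ‖picard f (N + 1) (y, t, r) - picard f N (y, t, r)‖ ≤
      (L * r) ^ (N + 1) / (N + 1).factorial * ‖y‖ := by
  induction N generalizing r with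
  | zero =>
    have h1 := norm_integral_le_sub_of_hasDerivAt
      (u := fun s => f (picard f 0 (y, t, s)) (t + s)) hr
      (by fun_prop) (hasDerivAt_pow_div_factorial L ‖y‖ 0)
      fun s hs => (norm_field_le hlip h0 _ _).trans (le_of_eq (by simp [picard]))
    rw [picard_succ]
    change ‖y + _ - y‖ ≤ _
    rw [add_sub_cancel_left]
    refine h1.trans (le_of_eq ?_)
    simp
  | succ N ih =>
    have h1 := norm_integral_le_sub_of_hasDerivAt
      (u := fun s => f (picard f (N + 1) (y, t, s)) (t + s) - f (picard f N (y, t, s)) (t + s)) hr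
      (by fun_prop) (hasDerivAt_pow_div_factorial L ‖y‖ (N + 1))
      fun s hs => (hlip _ _ _).trans (mul_le_mul_of_nonneg_left (ih hs.1) hL)
    rw [intervalIntegral.integral_sub
      ((continuous_picard_integrand hf (N + 1) y t).intervalIntegrable _ _)
      ((continuous_picard_integrand hf N y t).intervalIntegrable _ _)] at h1
    rw [picard_succ, picard_succ N, add_sub_add_left_eq_sub]
    refine h1.trans (le_of_eq ?_)
    simp

/-- The Picard iterates converge to a solution. -/
theorem exists_solvesFrom_tendsto_picard (hf : ContDiff ℝ 1 (fun p : E × ℝ => f p.1 p.2))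
    (hL : 0 ≤ L) (hlip : ∀ y z t, ‖f y t - f z t‖ ≤ L * ‖y - z‖) (h0 : ∀ t, f 0 t = 0) (y : E)
    (t : ℝ) : ∃ u : ℝ → E, u t = y ∧ SolvesFrom t u (fun s => f (u s) s) ∧
      ∀ r, 0 ≤ r → ∀ N, ‖picard f N (y, t, r) - u (t + r)‖ ≤
        (∑' k, (L * r) ^ (N + k + 1) / (N + k + 1).factorial) * ‖y‖ := by
  have hsummable : ∀ r : ℝ, Summable fun k : ℕ => (L * r) ^ (k + 1) / (k + 1).factorial * ‖y‖ :=
    fun r => ((summable_nat_add_iff 1).2 (Real.summable_pow_div_factorial (L * r))).mul_right _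
  have hdist : ∀ r, 0 ≤ r → ∀ N, dist (picard f N (y, t, r)) (picard f (N + 1) (y, t, r)) ≤
      (L * r) ^ (N + 1) / (N + 1).factorial * ‖y‖ := fun r hr N => by
    rw [dist_comm, dist_eq_norm]
    exact norm_picard_succ_sub_le hf hL hlip h0 N y t hr
  -- The value at `r < 0` is arbitrary; it only makes the chosen limit a total function.
  have hlim : ∀ r : ℝ, ∃ z, 0 ≤ r → Tendsto (fun N => picard f N (y, t, r)) atTop (𝓝 z) := by
    intro r
    by_cases hr : 0 ≤ r
    · obtain ⟨z, hz⟩ := cauchySeq_tendsto_of_complete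
        (cauchySeq_of_dist_le_of_summable _ (hdist r hr) (hsummable r))
      exact ⟨z, fun _ => hz⟩
    · exact ⟨0, fun h => absurd h hr⟩
  choose w hw using hlim
  have hftend : ∀ s, 0 ≤ s → Tendsto (fun N => f (picard f N (y, t, s)) (t + s)) atTop
      (𝓝 (f (w s) (t + s))) := fun s hs =>
    (hf.continuous.tendsto (w s, t + s)).comp ((hw s hs).prodMk_nhds tendsto_const_nhds)
  have hbound : ∀ r, 0 ≤ r → ∀ N, ∀ s ∈ uIoc 0 r, ‖f (picard f N (y, t, s)) (t + s)‖ ≤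
      L * (Real.exp (L * r) * ‖y‖) := by
    intro r hr N s hs
    rw [uIoc_of_le hr] at hs
    refine (norm_field_le hlip h0 _ _).trans (mul_le_mul_of_nonneg_left
      ((norm_picard_le hf hL hlip h0 N y t hs.1.le).trans ?_) hL)
    gcongr
    exact hs.2
  have hint : ∀ r, 0 ≤ r → IntervalIntegrable (fun s => f (w s) (t + s)) volume 0 r := by
    intro r hr
    have hae : ∀ᵐ s ∂(volume.restrict (uIoc 0 r)), s ∈ uIoc 0 r :=
      ae_restrict_mem measurableSet_uIoc
    refine (intervalIntegrable_const (c := L * (Real.exp (L * r) * ‖y‖))).mono_fun' ?_ ?_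
    · refine aestronglyMeasurable_of_tendsto_ae atTop
        (fun N => (continuous_picard_integrand hf N y t).aestronglyMeasurable) ?_
      filter_upwards [hae] with s hs
      rw [uIoc_of_le hr] at hs
      exact hftend s hs.1.le
    · filter_upwards [hae] with s hs
      refine le_of_tendsto (hftend s ?_).norm (Eventually.of_forall fun N => hbound r hr N s hs)
      rw [uIoc_of_le hr] at hs
      exact hs.1.le
  have heq : ∀ r, 0 ≤ r → w r = y + ∫ s in (0 : ℝ)..r, f (w s) (t + s) := by
    intro r hr
    have h1 : Tendsto (fun N => ∫ s in (0 : ℝ)..r, f (picard f N (y, t, s)) (t + s)) atTop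
        (𝓝 (∫ s in (0 : ℝ)..r, f (w s) (t + s))) := by
      refine intervalIntegral.tendsto_integral_filter_of_dominated_convergence
        (fun _ => L * (Real.exp (L * r) * ‖y‖))
        (Eventually.of_forall fun N => (continuous_picard_integrand hf N y t).aestronglyMeasurable)
        (Eventually.of_forall fun N => Eventually.of_forall fun s hs => hbound r hr N s hs)
        intervalIntegrable_const (Eventually.of_forall fun s hs => ?_)
      rw [uIoc_of_le hr] at hs
      exact hftend s hs.1.le
    exact tendsto_nhds_unique ((tendsto_add_atTop_iff_nat 1).2 (hw r hr)) (h1.const_add y)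
  have hw0 : w 0 = y := by simpa using heq 0 le_rfl
  refine ⟨fun s => w (s - t), by simp [hw0], fun s hs => ⟨?_, ?_⟩, fun r hr N => ?_⟩
  · have := (hint (s - t) (sub_nonneg.2 hs)).comp_sub_right t
    simpa using this
  · have h1 := intervalIntegral.integral_comp_sub_right (fun s => f (w s) (t + s)) t
      (a := t) (b := s)
    simp only [sub_self, add_sub_cancel] at h1
    simp only [sub_self, h1, hw0]
    exact heq _ (sub_nonneg.2 hs)
  · have := dist_le_tsum_of_dist_le_of_tendsto _ (hdist r hr) (hsummable r) (hw r hr) N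
    rw [tsum_mul_right, dist_eq_norm] at this
    simpa using this

/-- The derivative of a Picard iterate along the flow: an exact solution operator would be
constant in this direction. -/
theorem norm_fderiv_picard_flow_le (hf : ContDiff ℝ 1 (fun p : E × ℝ => f p.1 p.2)) (hL : 0 ≤ L)
    (hlip : ∀ y z t, ‖f y t - f z t‖ ≤ L * ‖y - z‖) (h0 : ∀ t, f 0 t = 0) (N : ℕ) (y : E) (t : ℝ)
    {r : ℝ} (hr : 0 ≤ r) : ‖fderiv ℝ (picard f N) (y, t, r) (f y t, 1, -1)‖ ≤
      (L * r) ^ N / N.factorial * (L * ‖y‖) := by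
  induction N generalizing r with
  | zero =>
    have : fderiv ℝ (picard f 0) (y, t, r) = ContinuousLinearMap.fst ℝ E (ℝ × ℝ) :=
      (ContinuousLinearMap.fst ℝ E (ℝ × ℝ)).fderiv
    rw [this]
    simpa using norm_field_le hlip h0 y t
  | succ N ih =>
    set v := f y t with hv
    have hcurve : ∀ s : ℝ, HasDerivAt (fun σ : ℝ => (y + σ • v, t + σ, s - σ)) (v, 1, -1) 0 := by
      intro s
      have h1 : HasDerivAt (fun σ : ℝ => y + σ • v) v 0 := by
        simpa using ((hasDerivAt_id (0 : ℝ)).smul_const v).const_add y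
      exact h1.prodMk (((hasDerivAt_id (0 : ℝ)).const_add t).prodMk
        ((hasDerivAt_id (0 : ℝ)).const_sub s))
    have hdiff : ∀ M s, HasDerivAt (fun σ : ℝ => picard f M (y + σ • v, t + σ, s - σ))
        (fderiv ℝ (picard f M) (y, t, s) (v, 1, -1)) 0 := by
      intro M s
      have h1 : HasFDerivAt (picard f M) (fderiv ℝ (picard f M) (y, t, s))
          (y + (0 : ℝ) • v, t + 0, s - 0) := by
        simpa using ((contDiff_picard hf M).differentiable (by simp) (y, t, s)).hasFDerivAt
      exact h1.comp_hasDerivAt (0 : ℝ) (hcurve s)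
    set k : ℝ → ℝ → E := fun σ s => f (picard f N (y + σ • v, t + σ, s - σ)) (t + s) with hk
    have hkc : ContDiff ℝ 1 (fun p : ℝ × ℝ => k p.1 p.2) := by
      have h1 : ContDiff ℝ 1 fun p : ℝ × ℝ => picard f N (y + p.1 • v, t + p.1, p.2 - p.1) :=
        (contDiff_picard hf N).comp (by fun_prop)
      exact hf.comp (h1.prodMk (by fun_prop : ContDiff ℝ 1 fun p : ℝ × ℝ => t + p.2))
    have hks : ∀ σ, Continuous (k σ) := fun σ => hkc.continuous.comp (Continuous.prodMk_right σ)
    -- Shifting `s` by `σ` frees the time argument of `f` from `σ` and moves the integral to `[σ,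
    -- r]`. The removed piece over `[0, σ]` has derivative `k 0 0 = v` at `σ = 0`, which cancels the
    -- derivative of `y + σ • v`.
    have hsucc : ∀ σ, picard f (N + 1) (y + σ • v, t + σ, r - σ) =
        y + σ • v + ((∫ s in (0 : ℝ)..r, k σ s) - σ • ∫ u in (0 : ℝ)..1, k σ (σ * u)) := by
      intro σ
      rw [intervalIntegral.smul_integral_comp_mul_left (k σ), mul_zero, mul_one,
        intervalIntegral.integral_interval_sub_left ((hks σ).intervalIntegrable _ _)
          ((hks σ).intervalIntegrable _ _), picard_succ]
      have := intervalIntegral.integral_comp_sub_right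
        (fun s => f (picard f N (y + σ • v, t + σ, s)) (t + σ + s)) σ (a := σ) (b := r)
      rw [sub_self] at this
      rw [← this]
      congr 1
      refine intervalIntegral.integral_congr fun s _ => ?_
      simp only [hk]
      congr 1
      ring
    have hI := (hasFDerivAt_intervalIntegral_of_contDiff hkc 0 r 0).hasDerivAt
    have hkc' : ContDiff ℝ 1 (fun p : ℝ × ℝ => k p.1 (p.1 * p.2)) :=
      hkc.comp (by fun_prop : ContDiff ℝ 1 fun p : ℝ × ℝ => (p.1, p.1 * p.2))
    have hJ := ((contDiff_intervalIntegral_of_contDiff (h := fun σ u => k σ (σ * u))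
      hkc' 0 1).differentiable (by simp) 0).hasDerivAt
    have hJ' := (hasDerivAt_id (0 : ℝ)).smul hJ
    have hlin : HasDerivAt (fun σ : ℝ => y + σ • v) v 0 := by
      simpa using ((hasDerivAt_id (0 : ℝ)).smul_const v).const_add y
    have htot := hlin.add (hI.sub hJ')
    have hk0 : k 0 0 = v := by simp [hk, picard_zero_time, hv]
    have hmain := (hdiff (N + 1) r).unique
      (htot.congr_of_eventuallyEq (Eventually.of_forall hsucc))
    have hDint : IntervalIntegrable (fun s => (fderiv ℝ (fun p : ℝ × ℝ => k p.1 p.2) (0, s)).comp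
        (ContinuousLinearMap.inl ℝ ℝ ℝ)) volume 0 r :=
      (((hkc.continuous_fderiv (by simp)).comp (Continuous.prodMk_right 0)).clm_comp
        continuous_const).intervalIntegrable _ _
    rw [ContinuousLinearMap.intervalIntegral_apply hDint] at hmain
    simp only [id_eq, zero_smul, one_smul, zero_mul, hk0, intervalIntegral.integral_const,
      sub_zero, zero_add, add_sub_cancel] at hmain
    rw [hmain]
    refine (norm_integral_le_sub_of_hasDerivAt hr (by fun_prop)
      (hasDerivAt_pow_div_factorial L (L * ‖y‖) N) fun s hs => ?_).trans (le_of_eq (by simp))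
    have hs1 : HasDerivAt (fun σ => k σ s) ((fderiv ℝ (fun p : ℝ × ℝ => k p.1 p.2) (0, s)).comp
        (ContinuousLinearMap.inl ℝ ℝ ℝ) 1) 0 :=
      ((hkc.differentiable (by simp) (0, s)).hasFDerivAt.comp (f := fun σ : ℝ => (σ, s)) (0 : ℝ)
        (hasFDerivAt_prodMk_left (0 : ℝ) s)).hasDerivAt
    have hfs : Differentiable ℝ fun z => f z (t + s) :=
      (hf.comp (by fun_prop : ContDiff ℝ 1 fun z : E => (z, t + s))).differentiable (by simp)
    -- The remaining integrand is the state derivative of `f`, of norm at most `L`, applied to the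
    -- same flow derivative of the previous iterate; this closes the induction.
    have hs2 : HasDerivAt (fun σ => k σ s) (fderiv ℝ (fun z => f z (t + s)) (picard f N (y, t, s))
        (fderiv ℝ (picard f N) (y, t, s) (v, 1, -1))) 0 := by
      have h1 : HasFDerivAt (fun z => f z (t + s))
          (fderiv ℝ (fun z => f z (t + s)) (picard f N (y, t, s)))
          (picard f N (y + (0 : ℝ) • v, t + 0, s - 0)) := by
        simpa using (hfs (picard f N (y, t, s))).hasFDerivAt
      exact h1.comp_hasDerivAt (0 : ℝ) (hdiff N s)
    rw [hs1.unique hs2]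
    have hlip' : ‖fderiv ℝ (fun z => f z (t + s)) (picard f N (y, t, s))‖ ≤ L := by
      refine norm_fderiv_le_of_lip' ℝ hL (Eventually.of_forall fun z => hlip _ _ _)
    exact (ContinuousLinearMap.le_opNorm _ _).trans
      (mul_le_mul hlip' (ih hs.1) (norm_nonneg _) hL)

theorem norm_fderiv_picard_state_le (hf : ContDiff ℝ 1 (fun p : E × ℝ => f p.1 p.2)) (hL : 0 ≤ L)
    (hlip : ∀ y z t, ‖f y t - f z t‖ ≤ L * ‖y - z‖) (N : ℕ) (y z : E) (t : ℝ)
    {r : ℝ} (hr : 0 ≤ r) :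
    ‖fderiv ℝ (picard f N) (y, t, r) (z, 0)‖ ≤ Real.exp (L * r) * ‖z‖ := by
  have h1 : HasFDerivAt (fun z => picard f N (z, t, r)) ((fderiv ℝ (picard f N) (y, t, r)).comp
      (ContinuousLinearMap.inl ℝ E (ℝ × ℝ))) y :=
    ((contDiff_picard hf N).differentiable (by simp) (y, t, r)).hasFDerivAt.comp y
      (hasFDerivAt_prodMk_left y (t, r))
  have h2 := h1.le_of_lip' (Real.exp_pos (L * r)).le
    (Eventually.of_forall fun z => norm_picard_sub_le hf hL hlip N z y t hr)
  exact (((fderiv ℝ (picard f N) (y, t, r)).comp (ContinuousLinearMap.inl ℝ E (ℝ × ℝ))).le_opNorm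
    z).trans (mul_le_mul_of_nonneg_right h2 (norm_nonneg z))

end Picard

/-! ## The converse Lyapunov theorem -/

section Converse

variable {E : Type*} [NormedAddCommGroup E] [InnerProductSpace ℝ E] [ProperSpace E]
  {f : E → ℝ → E} {L : ℝ}

/-- The squared norm of a Picard iterate, integrated over a time horizon `T`. -/
noncomputable def picardEnergy (f : E → ℝ → E) (N : ℕ) (T : ℝ) (y : E) (t : ℝ) : ℝ :=
  ∫ r in (0 : ℝ)..T, ‖picard f N (y, t, r)‖ ^ 2

theorem contDiff_norm_sq_picard (hf : ContDiff ℝ 1 (fun p : E × ℝ => f p.1 p.2)) (N : ℕ) :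
    ContDiff ℝ 1 fun p : (E × ℝ) × ℝ => ‖picard f N (p.1.1, p.1.2, p.2)‖ ^ 2 := by
  have h1 : ContDiff ℝ 1 fun p : (E × ℝ) × ℝ => picard f N (p.1.1, p.1.2, p.2) :=
    (contDiff_picard hf N).comp (by fun_prop)
  exact h1.norm_sq ℝ

theorem continuous_norm_sq_picard (hf : ContDiff ℝ 1 (fun p : E × ℝ => f p.1 p.2)) (N : ℕ)
    (y : E) (t : ℝ) : Continuous fun r => ‖picard f N (y, t, r)‖ ^ 2 :=
  (contDiff_norm_sq_picard hf N).continuous.comp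
    (by fun_prop : Continuous fun r : ℝ => ((y, t), r))

theorem contDiff_picardEnergy (hf : ContDiff ℝ 1 (fun p : E × ℝ => f p.1 p.2)) (N : ℕ) (T : ℝ) :
    ContDiff ℝ 1 (fun p : E × ℝ => picardEnergy f N T p.1 p.2) :=
  contDiff_intervalIntegral_of_contDiff
    (h := fun (q : E × ℝ) r => ‖picard f N (q.1, q.2, r)‖ ^ 2) (contDiff_norm_sq_picard hf N) 0 T

theorem fderiv_picardEnergy (hf : ContDiff ℝ 1 (fun p : E × ℝ => f p.1 p.2)) (N : ℕ) (T : ℝ)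
    (y : E) (t : ℝ) (w : E × ℝ) :
    fderiv ℝ (fun p : E × ℝ => picardEnergy f N T p.1 p.2) (y, t) w = ∫ r in (0 : ℝ)..T,
      2 * inner ℝ (picard f N (y, t, r)) (fderiv ℝ (picard f N) (y, t, r) (w.1, w.2, 0)) := by
  have hφ := contDiff_norm_sq_picard hf N
  refine (fderiv_intervalIntegral_apply
    (h := fun (q : E × ℝ) r => ‖picard f N (q.1, q.2, r)‖ ^ 2) hφ 0 T (y, t) w).trans ?_
  refine intervalIntegral.integral_congr fun r _ => ?_
  have h3 : HasFDerivAt (fun q : E × ℝ => (q.1, q.2, r))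
      ((ContinuousLinearMap.fst ℝ E ℝ).prod ((ContinuousLinearMap.snd ℝ E ℝ).prod 0)) (y, t) :=
    hasFDerivAt_fst.prodMk (hasFDerivAt_snd.prodMk (hasFDerivAt_const r _))
  have h4 := (((contDiff_picard hf N).differentiable (by simp) (y, t, r)).hasFDerivAt.comp
    (f := fun q : E × ℝ => (q.1, q.2, r)) (y, t) h3).norm_sq
  have h5 := (hφ.differentiable (by simp) ((y, t), r)).hasFDerivAt.comp
    (f := fun q : E × ℝ => (q, r)) (y, t) (hasFDerivAt_prodMk_left (y, t) r)
  have h6 := h5.unique h4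
  have h7 := congrArg (fun A : E × ℝ →L[ℝ] ℝ => A w) h6
  refine h7.trans ?_
  simp [two_mul]

theorem continuous_inner_fderiv_picard (hf : ContDiff ℝ 1 (fun p : E × ℝ => f p.1 p.2)) (N : ℕ)
    (y : E) (t : ℝ) (w : E × ℝ × ℝ) : Continuous fun r =>
      2 * inner ℝ (picard f N (y, t, r)) (fderiv ℝ (picard f N) (y, t, r) w) := by
  have hc : Continuous fun r : ℝ => ((y, t, r) : E × ℝ × ℝ) := by fun_prop
  have h1 : Continuous fun r => picard f N (y, t, r) := (contDiff_picard hf N).continuous.comp hc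
  have h2 : Continuous fun r => fderiv ℝ (picard f N) (y, t, r) w :=
    (((contDiff_picard hf N).continuous_fderiv (by simp)).comp hc).clm_apply continuous_const
  exact continuous_const.mul (h1.inner h2)

theorem norm_fderiv_picardEnergy_state_le (hf : ContDiff ℝ 1 (fun p : E × ℝ => f p.1 p.2))
    (hL : 0 ≤ L) (hlip : ∀ y z t, ‖f y t - f z t‖ ≤ L * ‖y - z‖) (h0 : ∀ t, f 0 t = 0) (N : ℕ)
    {T : ℝ} (hT : 0 ≤ T) (y : E) (t : ℝ) (z : E) :
    ‖fderiv ℝ (fun p : E × ℝ => picardEnergy f N T p.1 p.2) (y, t) (z, 0)‖ ≤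
      2 * Real.exp (L * T) ^ 2 * T * ‖y‖ * ‖z‖ := by
  rw [fderiv_picardEnergy hf]
  have h1 : ∀ r ∈ uIoc 0 T, ‖2 * inner ℝ (picard f N (y, t, r))
      (fderiv ℝ (picard f N) (y, t, r) (z, 0, 0))‖ ≤ 2 * Real.exp (L * T) ^ 2 * ‖y‖ * ‖z‖ := by
    intro r hr
    rw [uIoc_of_le hT] at hr
    have he : Real.exp (L * r) ≤ Real.exp (L * T) :=
      Real.exp_le_exp.2 (mul_le_mul_of_nonneg_left hr.2 hL)
    have h2 := (norm_picard_le hf hL hlip h0 N y t hr.1.le).trans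
      (mul_le_mul_of_nonneg_right he (norm_nonneg y))
    have h3 := (norm_fderiv_picard_state_le hf hL hlip N y z t hr.1.le).trans
      (mul_le_mul_of_nonneg_right he (norm_nonneg z))
    rw [norm_mul, Real.norm_of_nonneg zero_le_two]
    have h4 := (norm_inner_le_norm (𝕜 := ℝ) (picard f N (y, t, r))
      (fderiv ℝ (picard f N) (y, t, r) (z, 0, 0))).trans
      (mul_le_mul h2 h3 (norm_nonneg _) (by positivity))
    calc _ ≤ 2 * (Real.exp (L * T) * ‖y‖ * (Real.exp (L * T) * ‖z‖)) := by gcongr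
      _ = _ := by ring
  refine (intervalIntegral.norm_integral_le_of_norm_le_const h1).trans (le_of_eq ?_)
  rw [sub_zero, abs_of_nonneg hT]
  ring

/-- Split `(f, 1, 0) = (f, 1, -1) + (0, 0, 1)`. The first direction contributes only the Picard
error; the second is the `r`-derivative of the integrand and integrates to boundary terms. -/
theorem fderiv_picardEnergy_flow_le (hf : ContDiff ℝ 1 (fun p : E × ℝ => f p.1 p.2))
    (hL : 0 ≤ L) (hlip : ∀ y z t, ‖f y t - f z t‖ ≤ L * ‖y - z‖) (h0 : ∀ t, f 0 t = 0) (N : ℕ)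
    {T : ℝ} (hT : 0 ≤ T) (y : E) (t : ℝ) :
    fderiv ℝ (fun p : E × ℝ => picardEnergy f N T p.1 p.2) (y, t) (f y t, 1) ≤
      ‖picard f N (y, t, T)‖ ^ 2 - ‖y‖ ^ 2 +
        2 * Real.exp (L * T) * L * T * ((L * T) ^ N / N.factorial) * ‖y‖ ^ 2 := by
  rw [fderiv_picardEnergy hf]
  set e : ℝ → E := fun r => fderiv ℝ (picard f N) (y, t, r) (f y t, 1, -1)
  have hsplit : ∀ r, 2 * inner ℝ (picard f N (y, t, r))
      (fderiv ℝ (picard f N) (y, t, r) (f y t, 1, 0)) = 2 * inner ℝ (picard f N (y, t, r)) (e r) +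
        2 * inner ℝ (picard f N (y, t, r)) (fderiv ℝ (picard f N) (y, t, r) (0, 0, 1)) := by
    intro r
    have : ((f y t, 1, 0) : E × ℝ × ℝ) = (f y t, 1, -1) + (0, 0, 1) := by simp
    rw [this, map_add, inner_add_right, mul_add]
  simp only [hsplit]
  rw [intervalIntegral.integral_add
    ((continuous_inner_fderiv_picard hf N y t _).intervalIntegrable _ _)
    ((continuous_inner_fderiv_picard hf N y t _).intervalIntegrable _ _)]
  have hderiv : ∀ r : ℝ, HasDerivAt (fun r => ‖picard f N (y, t, r)‖ ^ 2)
      (2 * inner ℝ (picard f N (y, t, r)) (fderiv ℝ (picard f N) (y, t, r) (0, 0, 1))) r := by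
    intro r
    have h1 : HasDerivAt (fun r : ℝ => ((y, t, r) : E × ℝ × ℝ)) (0, 0, 1) r :=
      (hasDerivAt_const r y).prodMk ((hasDerivAt_const r t).prodMk (hasDerivAt_id r))
    exact (((contDiff_picard hf N).differentiable (by simp) (y, t, r)).hasFDerivAt.comp_hasDerivAt
      r h1).norm_sq
  rw [intervalIntegral.integral_eq_sub_of_hasDerivAt (fun r _ => hderiv r)
    ((continuous_inner_fderiv_picard hf N y t _).intervalIntegrable _ _), picard_zero_time]
  have h1 : ∀ r ∈ uIoc 0 T, ‖2 * inner ℝ (picard f N (y, t, r)) (e r)‖ ≤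
      2 * Real.exp (L * T) * L * ((L * T) ^ N / N.factorial) * ‖y‖ ^ 2 := by
    intro r hr
    rw [uIoc_of_le hT] at hr
    have hLr : L * r ≤ L * T := mul_le_mul_of_nonneg_left hr.2 hL
    have hLr0 : 0 ≤ L * r := mul_nonneg hL hr.1.le
    have h2 : ‖picard f N (y, t, r)‖ ≤ Real.exp (L * T) * ‖y‖ :=
      (norm_picard_le hf hL hlip h0 N y t hr.1.le).trans (by gcongr)
    have h3 : ‖e r‖ ≤ (L * T) ^ N / N.factorial * (L * ‖y‖) :=
      (norm_fderiv_picard_flow_le hf hL hlip h0 N y t hr.1.le).trans (by gcongr)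
    rw [norm_mul, Real.norm_of_nonneg zero_le_two]
    have h4 := (norm_inner_le_norm (𝕜 := ℝ) (picard f N (y, t, r)) (e r)).trans
      (mul_le_mul h2 h3 (norm_nonneg _) (by positivity))
    calc _ ≤ 2 * (Real.exp (L * T) * ‖y‖ * ((L * T) ^ N / N.factorial * (L * ‖y‖))) := by gcongr
      _ = _ := by ring
  have h2 := (le_abs_self _).trans (intervalIntegral.norm_integral_le_of_norm_le_const h1)
  rw [sub_zero, abs_of_nonneg hT] at h2
  linarith

theorem picardEnergy_le (hf : ContDiff ℝ 1 (fun p : E × ℝ => f p.1 p.2))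
    (hL : 0 ≤ L) (hlip : ∀ y z t, ‖f y t - f z t‖ ≤ L * ‖y - z‖) (h0 : ∀ t, f 0 t = 0) (N : ℕ)
    {T : ℝ} (hT : 0 ≤ T) (y : E) (t : ℝ) :
    picardEnergy f N T y t ≤ Real.exp (L * T) ^ 2 * T * ‖y‖ ^ 2 := by
  have h1 : ∀ r ∈ uIoc 0 T, ‖‖picard f N (y, t, r)‖ ^ 2‖ ≤ Real.exp (L * T) ^ 2 * ‖y‖ ^ 2 := by
    intro r hr
    rw [uIoc_of_le hT] at hr
    have hLr : L * r ≤ L * T := mul_le_mul_of_nonneg_left hr.2 hL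
    rw [Real.norm_of_nonneg (sq_nonneg _), ← mul_pow]
    have := norm_picard_le hf hL hlip h0 N y t hr.1.le
    gcongr
    exact this.trans (by gcongr)
  have h2 := (le_abs_self _).trans (intervalIntegral.norm_integral_le_of_norm_le_const h1)
  rw [sub_zero, abs_of_nonneg hT] at h2
  rw [picardEnergy]
  linarith

/-- Up to time `r₀` an iterate has moved by at most `‖y‖ / 2`, so its norm is still at least `‖y‖ /
2`. -/
theorem le_picardEnergy (hf : ContDiff ℝ 1 (fun p : E × ℝ => f p.1 p.2))
    (hL : 0 ≤ L) (hlip : ∀ y z t, ‖f y t - f z t‖ ≤ L * ‖y - z‖) (h0 : ∀ t, f 0 t = 0) (N : ℕ)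
    {T r₀ : ℝ} (hr₀ : 0 ≤ r₀) (hr₀T : r₀ ≤ T) (hexp : Real.exp (L * r₀) ≤ 3 / 2) (y : E) (t : ℝ) :
    r₀ / 4 * ‖y‖ ^ 2 ≤ picardEnergy f N T y t := by
  have hc := continuous_norm_sq_picard hf N y t
  have h1 : ∀ r ∈ Icc 0 r₀, ‖y‖ ^ 2 / 4 ≤ ‖picard f N (y, t, r)‖ ^ 2 := by
    intro r hr
    have h2 := norm_picard_sub_self_le hf hL hlip h0 N y t hr.1
    have h3 : Real.exp (L * r) ≤ 3 / 2 :=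
      (Real.exp_le_exp.2 (mul_le_mul_of_nonneg_left hr.2 hL)).trans hexp
    have h4 : ‖y‖ - ‖picard f N (y, t, r)‖ ≤ ‖picard f N (y, t, r) - y‖ := by
      rw [norm_sub_rev]; exact norm_sub_norm_le _ _
    have h5 : (Real.exp (L * r) - 1) * ‖y‖ ≤ 1 / 2 * ‖y‖ :=
      mul_le_mul_of_nonneg_right (by linarith) (norm_nonneg y)
    have h6 : ‖y‖ / 2 ≤ ‖picard f N (y, t, r)‖ := by linarith
    calc ‖y‖ ^ 2 / 4 = (‖y‖ / 2) ^ 2 := by ring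
      _ ≤ _ := by gcongr
  calc r₀ / 4 * ‖y‖ ^ 2 = ∫ _ in (0 : ℝ)..r₀, ‖y‖ ^ 2 / 4 := by
        rw [intervalIntegral.integral_const, sub_zero, smul_eq_mul]; ring
    _ ≤ ∫ r in (0 : ℝ)..r₀, ‖picard f N (y, t, r)‖ ^ 2 :=
        intervalIntegral.integral_mono_on hr₀ intervalIntegrable_const
          (hc.intervalIntegrable _ _) h1
    _ ≤ _ := intervalIntegral.integral_mono_interval le_rfl hr₀ hr₀T
        (Eventually.of_forall fun r => sq_nonneg _) (hc.intervalIntegrable _ _)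

/-- If the solutions of `dy/dt = f (y, t)` decay uniformly exponentially, then over a long horizon
sufficiently far Picard iterates yield a strict Lyapunov function. -/
theorem exists_picardEnergy_decay (hf : ContDiff ℝ 1 (fun p : E × ℝ => f p.1 p.2))
    (hL : 0 ≤ L) (hlip : ∀ y z t, ‖f y t - f z t‖ ≤ L * ‖y - z‖) (h0 : ∀ t, f 0 t = 0)
    {K μ : ℝ} (hμ : 0 < μ)
    (hdecay : ∀ t₀, 0 ≤ t₀ → ∀ u : ℝ → E, SolvesFrom t₀ u (fun s => f (u s) s) →
      ∀ t, t₀ ≤ t → ‖u t‖ ≤ K * ‖u t₀‖ * Real.exp (-μ * (t - t₀))) :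
    ∃ (N : ℕ) (T : ℝ), 0 < T ∧ ∀ y t, 0 ≤ t →
      fderiv ℝ (fun p : E × ℝ => picardEnergy f N T p.1 p.2) (y, t) (f y t, 1) ≤
        -(1 / 2) * ‖y‖ ^ 2 := by
  have hTlim : Tendsto (fun T => K * Real.exp (-μ * T)) atTop (𝓝 0) := by
    have h1 : Tendsto (fun T => -μ * T) atTop atBot :=
      tendsto_id.const_mul_atTop_of_neg (neg_neg_of_pos hμ)
    simpa using (Real.tendsto_exp_atBot.comp h1).const_mul K
  -- The budget: `1/4` for the exact solution at time `T` and `1/4` for the Picard tail give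
  -- `‖picard‖ ≤ ‖y‖ / 2`. With flow error at most `1/4`, the energy derivative is at most `(1/4 - 1
  -- + 1/4) ‖y‖² = -‖y‖² / 2`.
  obtain ⟨T, hTK, hT⟩ := ((hTlim.eventually_le_const (by norm_num : (0 : ℝ) < 1 / 4)).and
    (eventually_gt_atTop 0)).exists
  have hN1 : Tendsto (fun N : ℕ => ∑' k, (L * T) ^ (N + k + 1) / ((N + k + 1).factorial : ℝ)) atTop
      (𝓝 0) := by
    have := tendsto_sum_nat_add fun k : ℕ => (L * T) ^ (k + 1) / ((k + 1).factorial : ℝ)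
    simpa only [add_comm _ _] using this
  have hN2 : Tendsto (fun N : ℕ => 2 * Real.exp (L * T) * L * T * ((L * T) ^ N / N.factorial)) atTop
      (𝓝 0) := by
    simpa using (FloorSemiring.tendsto_pow_div_factorial_atTop (L * T)).const_mul
      (2 * Real.exp (L * T) * L * T)
  obtain ⟨N, h1, h2⟩ := ((hN1.eventually_le_const (by norm_num : (0 : ℝ) < 1 / 4)).and
    (hN2.eventually_le_const (by norm_num : (0 : ℝ) < 1 / 4))).exists
  refine ⟨N, T, hT, fun y t ht => ?_⟩
  obtain ⟨u, hut, hu, happrox⟩ := exists_solvesFrom_tendsto_picard hf hL hlip h0 y t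
  have h3 := hdecay t ht u hu (t + T) (by linarith)
  rw [hut, add_sub_cancel_left] at h3
  have h4 : ‖u (t + T)‖ ≤ 1 / 4 * ‖y‖ := by
    calc _ ≤ K * Real.exp (-μ * T) * ‖y‖ := by linarith
      _ ≤ _ := mul_le_mul_of_nonneg_right hTK (norm_nonneg y)
  have h5 : ‖picard f N (y, t, T) - u (t + T)‖ ≤ 1 / 4 * ‖y‖ :=
    (happrox T hT.le N).trans (mul_le_mul_of_nonneg_right h1 (norm_nonneg y))
  have h6 : ‖picard f N (y, t, T)‖ ≤ 1 / 2 * ‖y‖ := by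
    have := norm_le_norm_sub_add (picard f N (y, t, T)) (u (t + T))
    linarith
  have h7 : ‖picard f N (y, t, T)‖ ^ 2 ≤ (1 / 2 * ‖y‖) ^ 2 := by gcongr
  have h8 := mul_le_mul_of_nonneg_right h2 (sq_nonneg ‖y‖)
  have h9 := fderiv_picardEnergy_flow_le hf hL hlip h0 N hT.le y t
  linarith

end Converse

theorem SolvesFrom.congr {E : Type*} [NormedAddCommGroup E] [NormedSpace ℝ E] {t₀ : ℝ}
    {u v v' : ℝ → E} (h : SolvesFrom t₀ u v) (hv : ∀ s, t₀ ≤ s → v s = v' s) :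
    SolvesFrom t₀ u v' := by
  intro t ht
  have hEq : EqOn v v' (uIcc t₀ t) := fun s hs => by
    rw [uIcc_of_le ht] at hs
    exact hv s hs.1
  refine ⟨(h t ht).1.congr (hEq.mono uIoc_subset_uIcc), ?_⟩
  rw [(h t ht).2, intervalIntegral.integral_congr hEq]

/-- Converse Lyapunov theorem: a continuously differentiable, uniformly Lipschitz compressor with
uniformly globally exponentially stable dynamics has a Lyapunov function. -/
theorem exists_isLyapunovFor {d : ℕ} {C : EuclideanSpace ℝ (Fin d) → ℝ → EuclideanSpace ℝ (Fin d)}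
    (hC : UGES (fun y t => -C y t))
    (hdiff : ContDiffOn ℝ 1 (fun p : EuclideanSpace ℝ (Fin d) × ℝ => C p.1 p.2)
      (univ ×ˢ Ici (0 : ℝ)))
    (hlip : ∃ L : ℝ, ∀ y z t, 0 ≤ t → ‖C y t - C z t‖ ≤ L * ‖y - z‖) :
    ∃ (V : EuclideanSpace ℝ (Fin d) → ℝ → ℝ) (c₁ c₂ c₃ c₄ : ℝ), IsLyapunovFor C V c₁ c₂ c₃ c₄ := by
  obtain ⟨hC0, K, -, μ, hμ, hdecay⟩ := hC
  obtain ⟨L₀, hL₀⟩ := hlip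
  set f : EuclideanSpace ℝ (Fin d) → ℝ → EuclideanSpace ℝ (Fin d) :=
    reflectTime fun y t => -C y t
  have hfC : ∀ y t, 0 ≤ t → f y t = -C y t := fun y t ht => reflectTime_of_nonneg _ y ht
  have hf : ContDiff ℝ 1 (fun p : EuclideanSpace ℝ (Fin d) × ℝ => f p.1 p.2) :=
    contDiff_reflectTime hdiff.neg
  have hf0 : ∀ t, f 0 t = 0 := by
    intro t
    have h1 := hC0 (max t 0) (le_max_right _ _)
    have h2 := hC0 (max (-t) 0) (le_max_right _ _)
    have h3 := hC0 0 le_rfl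
    simp only [f, reflectTime, h1, h2, h3]
    simp
  -- The reflected field is a sum of three values of `±C`; the maximum with `1` makes the constant
  -- positive.
  set L : ℝ := 3 * max L₀ 1
  have hL : 0 < L := by positivity
  have hflip : ∀ y z t, ‖f y t - f z t‖ ≤ L * ‖y - z‖ := by
    intro y z t
    have h1 : ∀ s, 0 ≤ s → ‖C y s - C z s‖ ≤ max L₀ 1 * ‖y - z‖ := fun s hs =>
      (hL₀ y z s hs).trans (mul_le_mul_of_nonneg_right (le_max_left _ _) (norm_nonneg _))
    have h2 := h1 (max t 0) (le_max_right _ _)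
    have h3 := h1 (max (-t) 0) (le_max_right _ _)
    have h4 := h1 0 le_rfl
    have heq : f y t - f z t = -(C y (max t 0) - C z (max t 0)) +
        (C y (max (-t) 0) - C z (max (-t) 0)) + -(C y 0 - C z 0) := by
      simp only [f, reflectTime]; abel
    rw [heq]
    refine norm_add₃_le.trans ?_
    rw [norm_neg, norm_neg]
    simp only [L]
    linarith
  obtain ⟨N, T, hT, hV⟩ := exists_picardEnergy_decay hf hL.le hflip hf0 hμ
    fun t₀ ht₀ u hu => hdecay t₀ ht₀ u (hu.congr fun s hs => hfC _ s (ht₀.trans hs))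
  set V := picardEnergy f N T
  have hVc : ContDiff ℝ 1 (fun p : EuclideanSpace ℝ (Fin d) × ℝ => V p.1 p.2) :=
    contDiff_picardEnergy hf N T
  set D := fderiv ℝ (fun p : EuclideanSpace ℝ (Fin d) × ℝ => V p.1 p.2)
  have hVd : ∀ p, HasFDerivAt (fun p : EuclideanSpace ℝ (Fin d) × ℝ => V p.1 p.2) (D p) p :=
    fun p => (hVc.differentiable (by simp) p).hasFDerivAt
  have hstate : ∀ y t, HasFDerivAt (fun z => V z t)
      ((D (y, t)).comp (ContinuousLinearMap.inl ℝ _ ℝ)) y := fun y t =>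
    (hVd (y, t)).comp (f := fun z => (z, t)) y (hasFDerivAt_prodMk_left y t)
  have htime : ∀ y t, HasDerivAt (fun s => V y s) (D (y, t) (0, 1)) t := fun y t =>
    (hVd (y, t)).comp_hasDerivAt (f := fun s => (y, s)) t
      ((hasDerivAt_const t y).prodMk (hasDerivAt_id t))
  set r₀ := min T (Real.log (3 / 2) / L)
  have hlog : 0 < Real.log (3 / 2) := Real.log_pos (by norm_num)
  have hr₀ : 0 < r₀ := lt_min hT (div_pos hlog hL)
  have hr₀exp : Real.exp (L * r₀) ≤ 3 / 2 := by
    rw [← Real.le_log_iff_exp_le (by norm_num), mul_comm]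
    exact (le_div_iff₀ hL).1 (min_le_right _ _)
  refine ⟨V, r₀ / 4, Real.exp (L * T) ^ 2 * T, 1 / 2, 2 * Real.exp (L * T) ^ 2 * T,
    by positivity, by positivity, by positivity, by positivity, hVc.contDiffOn,
    fun y t _ => le_picardEnergy hf hL.le hflip hf0 N hr₀.le (min_le_left _ _) hr₀exp y t,
    fun y t _ => picardEnergy_le hf hL.le hflip hf0 N hT.le y t, fun y t ht => ?_,
    fun y t _ => ?_⟩
  · rw [(htime y t).hasDerivWithinAt.derivWithin (uniqueDiffOn_Ici 0 t ht), (hstate y t).fderiv]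
    have h1 := hV y t ht
    rw [hfC y t ht] at h1
    have h2 : D (y, t) (-C y t, 1) = D (y, t) (0, 1) - D (y, t) (C y t, 0) := by
      rw [← map_sub]; simp
    exact h2.symm.trans_le h1
  · rw [(hstate y t).fderiv]
    exact ContinuousLinearMap.opNorm_le_bound _ (by positivity) fun z =>
      norm_fderiv_picardEnergy_state_le hf hL.le hflip hf0 N hT.le y t z

/-! ## Main theorem -/

theorem theorem2 {n d : ℕ} (hn : 2 ≤ n)
    (G : SimpleGraph (Fin n)) (hG : G.Connected)
    (a : Matrix (Fin n) (Fin n) ℝ) (ha : IsWeightMatrix G a)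
    (C : EuclideanSpace ℝ (Fin d) → ℝ → EuclideanSpace ℝ (Fin d))
    (hC : IsSTCompressor C) (hC1 : UGES (fun y t => -C y t)) :
    -- Lyapunov functions exist if `C` is continuously differentiable and uniformly Lipschitz
    (ContDiffOn ℝ 1 (fun p : EuclideanSpace ℝ (Fin d) × ℝ => C p.1 p.2) (univ ×ˢ Ici (0 : ℝ)) →
      (∃ L : ℝ, ∀ y z t, 0 ≤ t → ‖C y t - C z t‖ ≤ L * ‖y - z‖) →
      ∃ (V : EuclideanSpace ℝ (Fin d) → ℝ → ℝ) (c₁ c₂ c₃ c₄ : ℝ),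
        IsLyapunovFor C V c₁ c₂ c₃ c₄) ∧
    -- every Lyapunov function gives the gain bound and the exponential rate
    (∀ (V : EuclideanSpace ℝ (Fin d) → ℝ → ℝ) (c₁ c₂ c₃ c₄ : ℝ),
      IsLyapunovFor C V c₁ c₂ c₃ c₄ →
      ∀ lam2 lamn : ℝ,
        lam2 = lapEigenvalue ha.symm ⟨1, by omega⟩ →
        lamn = lapEigenvalue ha.symm ⟨n - 1, by omega⟩ →
      ∀ α : ℝ, 0 < α →
        α ≤ min (2 * c₃ / (9 * lamn * c₄ * Real.sqrt n)) (2 * c₃ / (3 * lamn)) →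
      ∀ (x : Fin n → ℝ → EuclideanSpace ℝ (Fin d))
        (xh : Fin n → Fin n → ℝ → EuclideanSpace ℝ (Fin d)),
        IsDCOCFlow a C α x xh →
        ∀ i, (fun t => ‖x i t - (1 / (n : ℝ)) • ∑ j, x j 0‖ ^ 2) =O[atTop]
          fun t => Real.exp (-(min (α * lam2 / 2) (c₃ / (3 * c₁))) * t)) := by
  refine ⟨exists_isLyapunovFor hC1, ?_⟩
  rintro V c₁ c₂ c₃ c₄ hV _ lamn rfl hlamn α hα hαle x xh hflow i
  have hlam : ∀ k, lapEigenvalue ha.symm k ≤ lamn := fun k => by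
    rw [hlamn]
    exact lapEigenvalue_mono ha.symm (Fin.le_def.2 (Nat.le_sub_one_of_lt k.isLt))
  -- If `lamn` were zero, the second bound on `α` would be a division by zero, with value `0`,
  -- contradicting `0 < α`.
  have hlam0 : 0 < lamn := by
    refine lt_of_le_of_ne (hlamn ▸ lapEigenvalue_nonneg ha _) fun h => ?_
    have := hαle.trans (min_le_right _ _)
    rw [← h, mul_zero, div_zero] at this
    exact absurd hα this.not_gt
  -- Since `√n ≥ 1`, the first bound gives `α * lamn * c₄ ≤ 2 c₃ / 9`, and `3 · 2/9 < 1`.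
  have hgain : 3 * (α * lamn * c₄) ≤ c₃ := by
    have hsqrt : 1 ≤ Real.sqrt n := Real.one_le_sqrt.2 (by exact_mod_cast (by omega : 1 ≤ n))
    have hc₄ := hV.c₄_pos
    have hc₃ := hV.c₃_pos
    have h1 := (le_div_iff₀ (by positivity)).1 (hαle.trans (min_le_left _ _))
    have h2 : α * lamn * c₄ * 1 ≤ α * lamn * c₄ * Real.sqrt n := by gcongr
    linarith
  obtain ⟨Lc, hLc, hbound⟩ := hC.exists_bound
  have hC' : ∀ y t, 0 ≤ t → ‖C y t‖ ≤ Lc * ‖y‖ := fun y t ht => by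
    have h0 : C 0 t = 0 := neg_eq_zero.1 (hC1.1 t ht)
    simpa [h0] using hbound y t ht
  refine (hflow.isBigO ha hn (ha.self_mem_nbrs hG hn) hLc.le hC' hV hlam hlam0 hα hgain i).trans ?_
  refine IsBigO.of_bound 1 ?_
  filter_upwards [eventually_ge_atTop 0] with t ht
  rw [one_mul, Real.norm_of_nonneg (Real.exp_pos _).le, Real.norm_of_nonneg (Real.exp_pos _).le]
  exact Real.exp_le_exp.2 (mul_le_mul_of_nonneg_right (neg_le_neg (min_le_left _ _)) ht)
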